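/- Let $F$ be a non-archimedean local field with ring of integers $\mathfrak o$, uniformizer $\varpi$, residue field of order $q$ and absolute value normalized by $|\varpi|=q^{-1}$. Let $G=\mathrm{GL}_{2n}(F)$, $P$ its upper triangular Borel subgroup, $K=\mathrm{GL}_{2n}(\mathfrak o)$, $B\subset K$ the Iwahori subgroup of matrices that are upper triangular modulo the maximal ideal, $W=S_{2n}$ the Weyl group (permutation matrices), and $\Gamma\subset W$ the Weyl group of $\mathrm{Sp}_{2n}$, i.e. the permutations commuting with $i\mapsto 2n+1-i$. Let $\delta=(|\cdot|^{2n-1},|\cdot|^{2n-3},\dots,|\cdot|^{-2n+1})$ be the modular character of $P$. For an unramified character $\chi$ of $P$ let $I(\chi)$ be the space of locally constant $f:G\to\mathbb C$ with $f(pg)=\chi\delta^{1/2}(p)f(g)$, with $G$ acting by right translation $R$; for $w\in W$ put ${}^w\chi(a)=\chi(w^{-1}aw)$ for diagonal $a$. Let $\chi=(\chi_1,\dots,\chi_n,\chi_n^{-1},\dots,\chi_1^{-1})$ with $\chi_i=|\cdot|^{z_i}$, $z_i\in\mathbb C$. For $f\in C_c^\infty(G)$ put $\mathcal P_\chi(f)(g)=\int_P\chi^{-1}\delta^{1/2}(p)f(pg)\,dp\in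 I(\chi)$, where $dp$ is the left Haar measure with $\mathrm{vol}(P\cap K)=1$, and let $\phi_B=\mathcal P_\chi(1_B)$. Give $G$ the Haar measure with $\mathrm{vol}(B)=1$. Let $\psi$ be an additive character of $F$ of conductor $\mathfrak o$, let $S=\left\{\begin{pmatrix}g&\\&g\end{pmatrix}\begin{pmatrix}I&X\\&I\end{pmatrix}\right\}\subset G$ be the Shalika subgroup ($g\in\mathrm{GL}_n(F)$, $X\in\mathrm{Mat}_n(F)$), with character $\Psi(s)=\psi(\mathrm{tr}\,X)$, and let $H=\xi S\xi^{-1}$, $\Psi_H(h)=\Psi(\xi^{-1}h\xi)$, where $\xi=\begin{pmatrix}0&I\\w_0&0\end{pmatrix}$ and $w_0$ is the antidiagonal permutation matrix of size $n$. Let $\Lambda_H$ be a Shalika functional on $I(\chi)$, i.e. a linear functional with $\Lambda_H(R_h\phi)=\Psi_H(h)\Lambda_H(\phi)$ for all $h\in H$, $\phi\in I(\chi)$, and let $\Delta_H(f)=\Lambda_H(\mathcal P_\chi(f))$ be the corresponding distribution. We call $\Lambda_H$ normalized if $$\Delta_H(f)=\int_{PH}\chi^{-1}\delta^{1/2}(p(x))\,f(x)\,\Psi_H^{-1}(h(x))\,dx,\qquad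 x=p(x)h(x),$$ for all $f\in C_c^\infty(G)$ supported in $P\cdot H$. For $\lambda\in\mathbb Z^n$ let $g_\lambda=\mathrm{diag}(\varpi^{\lambda_1},\dots,\varpi^{\lambda_n},1,\dots,1)$. Let $\lambda_1\ge\dots\ge\lambda_n\ge0$ and $g=g_{-\lambda}$. Then: 1. $Bg^{-1}\subset P\cdot H$. 2. $\Lambda_H(R_g\phi_B)=\chi^{-1}\delta^{1/2}(g_\lambda)\,\Lambda_H(\phi_B)$; if $\Lambda_H$ is normalized, then $\Lambda_H(\phi_B)=1$ and $\Lambda_H(R_g\phi_B)=\chi^{-1}\delta^{1/2}(g_\lambda)$. 3. Suppose that the intertwining operators $T_w:I(\chi^{-1})\to I({}^w\chi^{-1})$, $w\in W$, and the Casselman basis $\{f_w\}_{w\in W}$ exist, as they do for $\chi$ in general position. Here $T_w$ is $G$-equivariant with $T_w\phi(1)=\int_{N\cap wN^-w^{-1}}\phi(w^{-1}u)\,du$ for $\phi$ supported in $\bigcup_{w'\not<w^{-1}}Pw'P$, where $<$ is the Bruhat order, $N$ and $N^-$ are the upper and lower triangular unipotent groups and $du$ is the Haar measure giving the integral points measure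 $1$; and $\{f_w\}$ is the basis of $I(\chi^{-1})^B$ with $T_w(f_{w'})(1)=\delta_{w,w'}$. For $\gamma\in G$ let $R_BR_{\gamma^{-1}}\Delta_H\in I(\chi^{-1})^B$ be the function $x\mapsto\Delta_H(R_\gamma 1_{xB})$, and let $a_w(\gamma)$ be its coefficients, $R_BR_{\gamma^{-1}}\Delta_H=\sum_{w\in W}a_w(\gamma)f_w$. Then for every $w\in\Gamma$ $$a_w(g_{-\lambda})={}^w\chi^{-1}\delta^{1/2}(g_\lambda)\;a_w(g_0),$$ that is, $\dfrac{a_w(g_{-\lambda})}{a_w(g_0)}={}^w\chi^{-1}\delta^{1/2}(g_\lambda)$ whenever $a_w(g_0)\neq0$. -/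

import Mathlib

open MeasureTheory Matrix
open scoped NNReal

noncomputable section

namespace Shalika

/-! ### Subgroups of the general linear group -/

/-- The Borel subgroup of upper triangular matrices in `GL_m(k)`. -/
def borelSubgroup (m : ℕ) (k : Type*) [Field k] : Subgroup (GL (Fin m) k) where
  carrier := {g | ∀ i j : Fin m, j < i → g i j = 0}
  mul_mem' {a b} ha hb := by
    have h := BlockTriangular.mul (M := a.val) (N := b.val) (b := (id : Fin m → Fin m))
      (fun i j h => ha i j h) (fun i j h => hb i j h)
    exact fun i j hij => h hij
  one_mem' := fun i j hij => by simp [hij.ne']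
  inv_mem' {a} ha := by
    let _ : Invertible a.val := a.invertible
    have h := blockTriangular_inv_of_blockTriangular (M := a.val) (b := (id : Fin m → Fin m))
      (fun i j h => ha i j h)
    intro i j hij
    have := h hij
    rwa [← Matrix.coe_units_inv] at this

lemma diag_mul_of_mem_borel {m : ℕ} {k : Type*} [Field k] {a b : GL (Fin m) k}
    (ha : a ∈ borelSubgroup m k) (hb : b ∈ borelSubgroup m k) (i : Fin m) :
    (a * b) i i = a i i * b i i := by
  rw [GeneralLinearGroup.coe_mul, Matrix.mul_apply, Finset.sum_eq_single i]
  · intro j _ hj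
    rcases lt_or_gt_of_ne hj with h | h
    · rw [ha i j h, zero_mul]
    · rw [hb j i h, mul_zero]
  · simp

/-- The group `N` of upper triangular matrices with ones on the diagonal. -/
def unipotentSubgroup (m : ℕ) (k : Type*) [Field k] : Subgroup (GL (Fin m) k) where
  carrier := {g | g ∈ borelSubgroup m k ∧ ∀ i : Fin m, g i i = 1}
  mul_mem' {a b} ha hb :=
    ⟨mul_mem ha.1 hb.1, fun i => by rw [diag_mul_of_mem_borel ha.1 hb.1, ha.2, hb.2, one_mul]⟩
  one_mem' := ⟨one_mem _, fun i => by simp⟩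
  inv_mem' {a} ha := by
    refine ⟨inv_mem ha.1, fun i => ?_⟩
    have h := diag_mul_of_mem_borel ha.1 (inv_mem ha.1) i
    rw [mul_inv_cancel, ha.2 i, one_mul] at h
    simpa using h.symm

/-- The permutation matrix of `w` in `GL_m(k)`; it sends the basis vector `e_i` to `e_{w i}`. -/
def permGL {m : ℕ} (k : Type*) [Field k] : Equiv.Perm (Fin m) →* GL (Fin m) k :=
  (permMatrixHom (n := Fin m) (R := k)).toHomUnits

/-- The opposite unipotent group `N⁻ = w_l N w_l⁻¹` of lower triangular matrices with ones on the
diagonal, where `w_l` is the longest Weyl group element `i ↦ m + 1 - i`. -/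
def oppUnipotentSubgroup (m : ℕ) (k : Type*) [Field k] : Subgroup (GL (Fin m) k) :=
  (unipotentSubgroup m k).map (MulAut.conj (permGL k (Fin.revPerm : Equiv.Perm (Fin m)))).toMonoidHom

/-- The group `N ∩ w N⁻ w⁻¹`, the product of the root groups `N^α` over the roots `α > 0` with
`w⁻¹ α < 0`; it represents the quotient `(w N w⁻¹ ∩ N) \ N`. -/
def rootSubgroup {m : ℕ} (k : Type*) [Field k] (w : Equiv.Perm (Fin m)) :
    Subgroup (GL (Fin m) k) :=
  unipotentSubgroup m k ⊓ (oppUnipotentSubgroup m k).map (MulAut.conj (permGL k w)).toMonoidHom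

/-- Square matrices of size `2n`, given by four blocks of size `n`. -/
def blocks {n : ℕ} {k : Type*} (A B C D : Matrix (Fin n) (Fin n) k) :
    Matrix (Fin (n + n)) (Fin (n + n)) k :=
  Matrix.reindex finSumFinEquiv finSumFinEquiv (Matrix.fromBlocks A B C D)

lemma blocks_mul {n : ℕ} {k : Type*} [Field k] (A B C D A' B' C' D' : Matrix (Fin n) (Fin n) k) :
    blocks A B C D * blocks A' B' C' D' =
      blocks (A * A' + B * C') (A * B' + B * D') (C * A' + D * C') (C * B' + D * D') := by
  simp only [blocks, Matrix.reindex_apply, Matrix.submatrix_mul_equiv, Matrix.fromBlocks_multiply]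

lemma blocks_one {n : ℕ} {k : Type*} [Field k] :
    (blocks 1 0 0 1 : Matrix (Fin (n + n)) (Fin (n + n)) k) = 1 := by
  simp [blocks, Matrix.fromBlocks_one]

/-- The Shalika subgroup `S` of `GL_{2n}(k)`: the matrices `diag(g, g) * (I X; 0 I)`. -/
def shalikaSubgroup (n : ℕ) (k : Type*) [Field k] : Subgroup (GL (Fin (n + n)) k) where
  carrier := {s | ∃ (g : GL (Fin n) k) (X : Matrix (Fin n) (Fin n) k),
    (s : Matrix (Fin (n + n)) (Fin (n + n)) k) =
      blocks (g : Matrix (Fin n) (Fin n) k) 0 0 (g : Matrix (Fin n) (Fin n) k) * blocks 1 X 0 1}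
  mul_mem' := by
    rintro a b ⟨g, X, ha⟩ ⟨h, Y, hb⟩
    refine ⟨g * h, Y + (h⁻¹ : GL (Fin n) k) * X * h, ?_⟩
    rw [GeneralLinearGroup.coe_mul, ha, hb]
    simp only [blocks_mul, GeneralLinearGroup.coe_mul]
    simp [Matrix.mul_add, Matrix.mul_assoc]
  one_mem' := ⟨1, 0, by simp [blocks_one]⟩
  inv_mem' := by
    rintro a ⟨g, X, ha⟩
    refine ⟨g⁻¹, -(g * X * (g⁻¹ : GL (Fin n) k)), ?_⟩
    rw [Matrix.coe_units_inv, ha]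
    apply Matrix.inv_eq_right_inv
    simp only [blocks_mul]
    rw [← blocks_one]
    simp [← Matrix.mul_assoc]

/-- The matrix `w_0` of size `n` with ones on the antidiagonal. -/
def antidiag (n : ℕ) (k : Type*) [Field k] : Matrix (Fin n) (Fin n) k :=
  Matrix.of fun i j => if j = i.rev then 1 else 0

lemma antidiag_mul_self (n : ℕ) (k : Type*) [Field k] : antidiag n k * antidiag n k = 1 := by
  ext i j
  rw [Matrix.mul_apply, Finset.sum_eq_single i.rev]
  · simp [antidiag, Matrix.one_apply, eq_comm]
  · intro k _ hk
    simp [antidiag, hk]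
  · simp

/-- The matrix `ξ = (0 I; w_0 0)`. -/
def xi (n : ℕ) (k : Type*) [Field k] : GL (Fin (n + n)) k where
  val := blocks 0 1 (antidiag n k) 0
  inv := blocks 0 (antidiag n k) 1 0
  val_inv := by simp [blocks_mul, antidiag_mul_self, blocks_one]
  inv_val := by simp [blocks_mul, antidiag_mul_self, blocks_one]

/-- The conjugate `H = ξ S ξ⁻¹` of the Shalika subgroup. -/
def conjShalika (n : ℕ) (k : Type*) [Field k] : Subgroup (GL (Fin (n + n)) k) :=
  (shalikaSubgroup n k).map (MulAut.conj (xi n k)).toMonoidHom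

/-- The character `Ψ(diag(g, g) * (I X; 0 I)) = ψ(tr X)`. It is written for every matrix, with
`X = A⁻¹ B` where `A`, `B` are the upper blocks, but is only used on the Shalika subgroup. -/
def shalikaChar {n : ℕ} {k : Type*} [Field k] (ψ : AddChar k ℂ) (s : GL (Fin (n + n)) k) : ℂ :=
  let M := Matrix.reindex finSumFinEquiv.symm finSumFinEquiv.symm
    (s : Matrix (Fin (n + n)) (Fin (n + n)) k)
  ψ (Matrix.trace (M.toBlocks₁₁⁻¹ * M.toBlocks₁₂))

/-- The character `Ψ_H(h) = Ψ(ξ⁻¹ h ξ)` of `H`. -/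
def conjShalikaChar {n : ℕ} {k : Type*} [Field k] (ψ : AddChar k ℂ) (h : GL (Fin (n + n)) k) : ℂ :=
  shalikaChar ψ ((xi n k)⁻¹ * h * xi n k)

/-- The diagonal matrix `g_λ = diag(ϖ^{λ_1}, …, ϖ^{λ_n}, 1, …, 1)`. -/
def gLam {n : ℕ} {k : Type*} [Field k] (ϖ : kˣ) (l : Fin n → ℤ) : GL (Fin (n + n)) k :=
  Units.map (Matrix.diagonalRingHom (Fin (n + n)) k).toMonoidHom
    (MulEquiv.piUnits.symm (Fin.append (fun i => ϖ ^ l i) (fun _ => 1)))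

/-- The Weyl group of `Sp_{2n}` inside that of `GL_{2n}`: the permutations that respect the pairs
`{i, 2n + 1 - i}`. -/
def weylSp (n : ℕ) : Subgroup (Equiv.Perm (Fin (n + n))) :=
  Subgroup.centralizer {Fin.revPerm}

/-! ### The local field -/

section LocalField

variable (F : Type*) [NontriviallyNormedField F] [IsUltrametricDist F]

/-- The ring of integers of `F`. -/
abbrev integers : ValuationSubring F := (NormedField.valuation (K := F)).valuationSubring

/-- The residue field of `F`. -/
abbrev residueField : Type _ := IsLocalRing.ResidueField (integers F)

/-- The maximal compact subgroup `K = GL_m(𝔬)` of `GL_m(F)`. -/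
def maxCompact (m : ℕ) : Subgroup (GL (Fin m) F) :=
  (GeneralLinearGroup.map (n := Fin m) (integers F).subtype).range

/-- The standard Iwahori subgroup `B`: the matrices in `GL_m(𝔬)` whose reduction modulo the
maximal ideal is upper triangular. -/
def iwahori (m : ℕ) : Subgroup (GL (Fin m) F) :=
  ((borelSubgroup m (residueField F)).comap
    (GeneralLinearGroup.map (IsLocalRing.residue (integers F)))).map
    (GeneralLinearGroup.map (integers F).subtype)

variable {F}

lemma mem_integers (x : F) : x ∈ integers F ↔ ‖x‖ ≤ 1 := by
  rw [Valuation.mem_valuationSubring_iff]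
  exact Iff.rfl

lemma residue_eq_zero_iff (x : integers F) :
    IsLocalRing.residue (integers F) x = 0 ↔ ‖(x : F)‖ < 1 := by
  rw [IsLocalRing.residue_eq_zero_iff, IsLocalRing.mem_maximalIdeal, mem_nonunits_iff]
  have hx : ‖(x : F)‖ ≤ 1 := (mem_integers _).1 x.2
  constructor
  · intro h
    refine lt_of_le_of_ne hx fun h1 => h ?_
    have h0 : (x : F) ≠ 0 := by
      intro h0
      rw [h0, norm_zero] at h1
      exact zero_ne_one h1
    have hy : (x : F)⁻¹ ∈ integers F := by rw [mem_integers, norm_inv, h1, inv_one]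
    exact IsUnit.of_mul_eq_one ⟨(x : F)⁻¹, hy⟩ (Subtype.ext (mul_inv_cancel₀ h0))
  · rintro h ⟨u, rfl⟩
    have h1 : ((u : integers F) : F) * ((u⁻¹ : (integers F)ˣ) : integers F) = 1 := by
      exact_mod_cast congrArg Subtype.val (u.mul_inv)
    have h2 : ‖(((u⁻¹ : (integers F)ˣ) : integers F) : F)‖ ≤ 1 := (mem_integers _).1 (Subtype.prop _)
    have h3 := congrArg norm h1
    rw [norm_mul, norm_one] at h3
    nlinarith [norm_nonneg ((u : integers F) : F),
      norm_nonneg (((u⁻¹ : (integers F)ˣ) : integers F) : F)]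

lemma mem_maxCompact_iff {m : ℕ} (g : GL (Fin m) F) :
    g ∈ maxCompact F m ↔ ∀ i j, ‖g i j‖ ≤ 1 ∧ ‖(g⁻¹ : GL (Fin m) F) i j‖ ≤ 1 := by
  constructor
  · rintro ⟨u, rfl⟩ i j
    refine ⟨(mem_integers _).1 (u i j).2, ?_⟩
    rw [← map_inv]
    exact (mem_integers _).1 ((u⁻¹ : GL (Fin m) (integers F)) i j).2
  · intro h
    let A : Matrix (Fin m) (Fin m) (integers F) :=
      Matrix.of fun i j => ⟨g i j, (mem_integers _).2 (h i j).1⟩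
    let A' : Matrix (Fin m) (Fin m) (integers F) :=
      Matrix.of fun i j => ⟨(g⁻¹ : GL (Fin m) F) i j, (mem_integers _).2 (h i j).2⟩
    have hinj : Function.Injective ((integers F).subtype.mapMatrix (m := Fin m)) :=
      Matrix.map_injective Subtype.val_injective
    have hA : (integers F).subtype.mapMatrix A = g.val := by ext i j; rfl
    have hA' : (integers F).subtype.mapMatrix A' = (g⁻¹ : GL (Fin m) F).val := by ext i j; rfl
    refine ⟨⟨A, A', hinj ?_, hinj ?_⟩, ?_⟩
    · rw [map_mul, hA, hA', map_one, Units.mul_inv]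
    · rw [map_mul, hA, hA', map_one, Units.inv_mul]
    · ext i j; rfl

lemma mem_iwahori_iff {m : ℕ} (g : GL (Fin m) F) :
    g ∈ iwahori F m ↔ g ∈ maxCompact F m ∧ ∀ i j : Fin m, j < i → ‖g i j‖ < 1 := by
  constructor
  · rintro ⟨u, hu, rfl⟩
    exact ⟨⟨u, rfl⟩, fun i j hij => (residue_eq_zero_iff _).1 (hu i j hij)⟩
  · rintro ⟨⟨u, rfl⟩, h⟩
    exact ⟨u, fun i j hij => (residue_eq_zero_iff _).2 (h i j hij), rfl⟩

lemma iwahori_mem_nhds (m : ℕ) : (iwahori F m : Set (GL (Fin m) F)) ∈ nhds 1 := by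
  have hc : ∀ i j : Fin m, Continuous fun g : GL (Fin m) F => g i j := fun i j =>
    Units.continuous_val.matrix_elem i j
  have hc' : ∀ i j : Fin m, Continuous fun g : GL (Fin m) F => (g⁻¹ : GL (Fin m) F) i j :=
    fun i j => (hc i j).comp continuous_inv
  have h1 : ∀ i j : Fin m, ∀ᶠ g : GL (Fin m) F in nhds 1,
      ‖g i j - (1 : GL (Fin m) F) i j‖ < 1 := fun i j =>
    ((hc i j).sub continuous_const).norm.continuousAt.eventually_lt continuousAt_const (by simp)
  have h2 : ∀ i j : Fin m, ∀ᶠ g : GL (Fin m) F in nhds 1,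
      ‖(g⁻¹ : GL (Fin m) F) i j - (1 : GL (Fin m) F) i j‖ < 1 := fun i j =>
    ((hc' i j).sub continuous_const).norm.continuousAt.eventually_lt continuousAt_const (by simp)
  have one_le : ∀ i j : Fin m, ‖(1 : GL (Fin m) F) i j‖ ≤ 1 := fun i j => by
    by_cases h : i = j
    · subst h; simp
    · simp [Matrix.one_apply_ne h]
  have key : ∀ (x : F) (i j : Fin m), ‖x - (1 : GL (Fin m) F) i j‖ < 1 → ‖x‖ ≤ 1 := by
    intro x i j h
    have := IsUltrametricDist.norm_add_le_max (x - (1 : GL (Fin m) F) i j) ((1 : GL (Fin m) F) i j)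
    rw [sub_add_cancel] at this
    exact this.trans (max_le h.le (one_le i j))
  filter_upwards [Filter.eventually_all.2 fun i => Filter.eventually_all.2 (h1 i),
    Filter.eventually_all.2 fun i => Filter.eventually_all.2 (h2 i)] with g hg hg'
  refine (mem_iwahori_iff g).2 ⟨(mem_maxCompact_iff g).2 fun i j =>
    ⟨key _ i j (hg i j), key _ i j (hg' i j)⟩, fun i j hij => ?_⟩
  simpa [Matrix.one_apply_ne hij.ne'] using hg i j

/-- `ϖ` is a uniformizing element: it generates the maximal ideal of the ring of integers. -/
def IsUniformizer (ϖ : F) : Prop := ∀ x : F, ‖x‖ < 1 ↔ ‖x‖ ≤ ‖ϖ‖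

/-- The conductor of the additive character `ψ` is the ring of integers: `ψ` is trivial on a
fractional ideal `x 𝔬` exactly when it is contained in `𝔬`. -/
def HasConductorIntegers (ψ : AddChar F ℂ) : Prop :=
  ∀ x : F, (∀ y : F, ‖y‖ ≤ ‖x‖ → ψ y = 1) ↔ ‖x‖ ≤ 1

/-! ### Principal series -/

/-- The unramified character `χ = (|·|^{z_1}, …, |·|^{z_m})` of the Borel subgroup. It is written
for every matrix, through the diagonal entries, but is only used on upper triangular ones. The
inverse of `χ` has parameter `-z`. -/
def unramChar {m : ℕ} (z : Fin m → ℂ) (p : GL (Fin m) F) : ℂ :=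
  ∏ i, (‖p i i‖ : ℂ) ^ z i

/-- The modular character `δ = (|·|^{m-1}, |·|^{m-3}, …, |·|^{-m+1})` of the Borel subgroup. -/
def delta {m : ℕ} (p : GL (Fin m) F) : ℝ :=
  ∏ i : Fin m, ‖p i i‖ ^ ((m : ℤ) - 1 - 2 * (i : ℤ))

/-- The character `χ δ^{1/2}`. -/
def chiDeltaHalf {m : ℕ} (z : Fin m → ℂ) (p : GL (Fin m) F) : ℂ :=
  unramChar z p * (Real.sqrt (delta p) : ℂ)

/-- The parameter of `^wχ`, where `^wχ(a) = χ(w⁻¹ a w)` for diagonal `a`. -/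
def twist {m : ℕ} (w : Equiv.Perm (Fin m)) (z : Fin m → ℂ) : Fin m → ℂ := fun i => z (w⁻¹ i)

/-- Right translation, `(R_g f)(x) = f(xg)`. -/
def rightTrans {m : ℕ} (g : GL (Fin m) F) (f : GL (Fin m) F → ℂ) : GL (Fin m) F → ℂ :=
  fun x => f (x * g)

/-- The unramified principal series `I(χ)`, `χ = (|·|^{z_1}, …, |·|^{z_m})`. -/
def principalSeries {m : ℕ} (z : Fin m → ℂ) : Submodule ℂ (GL (Fin m) F → ℂ) where
  carrier := {f | IsLocallyConstant f ∧
    ∀ p ∈ borelSubgroup m F, ∀ g, f (p * g) = chiDeltaHalf z p * f g}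
  add_mem' {f₁ f₂} h₁ h₂ := ⟨h₁.1.add h₂.1, fun p hp g => by
    simp only [Pi.add_apply, h₁.2 p hp g, h₂.2 p hp g, mul_add]⟩
  zero_mem' := ⟨IsLocallyConstant.const 0, fun p _ g => by simp⟩
  smul_mem' c f h := ⟨h.1.comp (fun y => c • y), fun p hp g => by
    simp only [Pi.smul_apply, h.2 p hp g, smul_eq_mul]; ring⟩

/-- The action of `g` on `I(χ)` by right translation. -/
def R {m : ℕ} {z : Fin m → ℂ} (g : GL (Fin m) F) :
    principalSeries (F := F) z →ₗ[ℂ] principalSeries (F := F) z where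
  toFun φ := ⟨rightTrans g φ, φ.2.1.comp_continuous (continuous_mul_const g), fun p hp x => by
    have := φ.2.2 p hp (x * g)
    rwa [← mul_assoc] at this⟩
  map_add' _ _ := rfl
  map_smul' _ _ := rfl

/-- The subspace `I(χ)^B` of invariants of the Iwahori subgroup. -/
def iwahoriInvariants {m : ℕ} (z : Fin m → ℂ) : Submodule ℂ (principalSeries (F := F) z) where
  carrier := {φ | ∀ b ∈ iwahori F m, R b φ = φ}
  add_mem' {φ₁ φ₂} h₁ h₂ b hb := by rw [map_add, h₁ b hb, h₂ b hb]
  zero_mem' b _ := map_zero _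
  smul_mem' c φ h b hb := by rw [map_smul, h b hb]

/-- The space `C_c^∞(G)` of locally constant functions with compact support. -/
def IsTestFunction {m : ℕ} (f : GL (Fin m) F → ℂ) : Prop :=
  IsLocallyConstant f ∧ HasCompactSupport f

/-- The extension by zero of a functional on `I(χ)` to all functions. -/
def extendZero {m : ℕ} {z : Fin m → ℂ} (Λ : principalSeries (F := F) z →ₗ[ℂ] ℂ)
    (f : GL (Fin m) F → ℂ) : ℂ :=
  open Classical in if h : f ∈ principalSeries z then Λ ⟨f, h⟩ else 0

lemma extendZero_smul {m : ℕ} {z : Fin m → ℂ} (Λ : principalSeries (F := F) z →ₗ[ℂ] ℂ)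
    (f : GL (Fin m) F → ℂ) (c : ℂ) (hc : c ≠ 0) :
    extendZero Λ (c • f) = c * extendZero Λ f := by
  unfold extendZero
  by_cases h : f ∈ principalSeries z
  · rw [dif_pos h, dif_pos (Submodule.smul_mem _ c h), ← smul_eq_mul, ← map_smul]
    rfl
  · rw [dif_neg h, dif_neg (fun h' => h ((Submodule.smul_mem_iff _ hc).1 h')), mul_zero]

lemma diag_ne_zero {m : ℕ} {p : GL (Fin m) F} (hp : p ∈ borelSubgroup m F) (i : Fin m) :
    p i i ≠ 0 := by
  have h := diag_mul_of_mem_borel hp (inv_mem hp) i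
  rw [mul_inv_cancel] at h
  intro h0
  simp [h0] at h

lemma delta_pos {m : ℕ} {p : GL (Fin m) F} (hp : p ∈ borelSubgroup m F) : 0 < delta p :=
  Finset.prod_pos fun i _ => zpow_pos (norm_pos_iff.2 (diag_ne_zero hp i)) _

lemma chiDeltaHalf_ne_zero {m : ℕ} (z : Fin m → ℂ) {p : GL (Fin m) F}
    (hp : p ∈ borelSubgroup m F) : chiDeltaHalf z p ≠ 0 := by
  refine mul_ne_zero (Finset.prod_ne_zero_iff.2 fun i _ => ?_) ?_
  · rw [Complex.cpow_def_of_ne_zero (by simpa using diag_ne_zero hp i)]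
    exact Complex.exp_ne_zero _
  · exact_mod_cast (Real.sqrt_pos.2 (delta_pos hp)).ne'

lemma chiDeltaHalf_mul {m : ℕ} (z : Fin m → ℂ) {p q : GL (Fin m) F}
    (hp : p ∈ borelSubgroup m F) (hq : q ∈ borelSubgroup m F) :
    chiDeltaHalf z (p * q) = chiDeltaHalf z p * chiDeltaHalf z q := by
  have h1 : unramChar z (p * q) = unramChar z p * unramChar z q := by
    unfold unramChar
    rw [← Finset.prod_mul_distrib]
    refine Finset.prod_congr rfl fun i _ => ?_
    rw [diag_mul_of_mem_borel hp hq, norm_mul, Complex.ofReal_mul,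
      Complex.mul_cpow_ofReal_nonneg (norm_nonneg _) (norm_nonneg _)]
  have h2 : delta (p * q) = delta p * delta q := by
    unfold delta
    rw [← Finset.prod_mul_distrib]
    refine Finset.prod_congr rfl fun i _ => ?_
    rw [diag_mul_of_mem_borel hp hq, norm_mul, mul_zpow]
  unfold chiDeltaHalf
  rw [h1, h2, Real.sqrt_mul (delta_pos hp).le, Complex.ofReal_mul]
  ring

/-! ### Distributions -/

section Measure

variable {m : ℕ} [MeasurableSpace (GL (Fin m) F)]

/-- The map `𝒫_χ : C_c^∞(G) → I(χ)`, `𝒫_χ(f)(g) = ∫_P χ⁻¹ δ^{1/2}(p) f(pg) dp`, for the left Haar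
measure `μP` on `P`. -/
def Pchi (μP : Measure (borelSubgroup m F)) (z : Fin m → ℂ) (f : GL (Fin m) F → ℂ) :
    GL (Fin m) F → ℂ :=
  fun g => ∫ p : borelSubgroup m F, chiDeltaHalf (-z) (p : GL (Fin m) F) * f (p * g) ∂μP

/-- The function `φ_B = 𝒫_χ(1_B)`. -/
def phiB (μP : Measure (borelSubgroup m F)) (z : Fin m → ℂ) : GL (Fin m) F → ℂ :=
  Pchi μP z ((iwahori F m : Set (GL (Fin m) F)).indicator 1)

/-- The distribution `Δ` on `G` that corresponds to a functional `Λ` on `I(χ)`: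
`Δ(f) = Λ(𝒫_χ(f))` for test functions `f`. -/
def distribution (μP : Measure (borelSubgroup m F)) {z : Fin m → ℂ}
    (Λ : principalSeries (F := F) z →ₗ[ℂ] ℂ) (f : GL (Fin m) F → ℂ) : ℂ :=
  extendZero Λ (Pchi μP z f)

lemma Pchi_left [BorelSpace (GL (Fin m) F)] (μP : Measure (borelSubgroup m F))
    [μP.IsHaarMeasure] (z : Fin m → ℂ) (f : GL (Fin m) F → ℂ) {p : GL (Fin m) F}
    (hp : p ∈ borelSubgroup m F) :
    Pchi μP z (fun y => f (p⁻¹ * y)) = chiDeltaHalf (-z) p • Pchi μP z f := by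
  funext g
  have h := integral_mul_left_eq_self (μ := μP)
    (fun q : borelSubgroup m F => chiDeltaHalf (-z) (q : GL (Fin m) F) *
      f (p⁻¹ * ((q : GL (Fin m) F) * g))) ⟨p, hp⟩
  simp only [Pchi, Pi.smul_apply, smul_eq_mul]
  rw [← h, ← integral_const_mul]
  congr 1
  funext q
  rw [Subgroup.coe_mul, chiDeltaHalf_mul (-z) hp q.2, mul_assoc p, inv_mul_cancel_left]
  ring

/-- The projection `R_B (R_{g⁻¹} Δ)` to the `B`-invariants `I(χ⁻¹)^B`. For a distribution `D` the
function `R_B D` is `x ↦ ∫_G D(b) 1_B(x⁻¹ b) db = D(1_{xB})`, and `(R_{g⁻¹} Δ)(f) = Δ(R_g f)`. -/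
def projB [BorelSpace (GL (Fin m) F)] (μP : Measure (borelSubgroup m F)) [μP.IsHaarMeasure]
    {z : Fin m → ℂ} (Λ : principalSeries (F := F) z →ₗ[ℂ] ℂ) (g : GL (Fin m) F) :
    iwahoriInvariants (F := F) (-z) :=
  let D : (GL (Fin m) F → ℂ) → ℂ := fun f => distribution μP Λ (rightTrans g f)
  let Φ : GL (Fin m) F → ℂ :=
    fun x => D (fun y => (iwahori F m : Set (GL (Fin m) F)).indicator 1 (x⁻¹ * y))
  have hB : ∀ b ∈ iwahori F m, ∀ x, Φ (x * b) = Φ x := by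
    intro b hb x
    have : (fun y => (iwahori F m : Set (GL (Fin m) F)).indicator (1 : GL (Fin m) F → ℂ)
        ((x * b)⁻¹ * y)) =
        fun y => (iwahori F m : Set (GL (Fin m) F)).indicator 1 (x⁻¹ * y) := by
      funext y
      have : (x * b)⁻¹ * y ∈ (iwahori F m : Set (GL (Fin m) F)) ↔
          x⁻¹ * y ∈ (iwahori F m : Set (GL (Fin m) F)) := by
        rw [_root_.mul_inv_rev, mul_assoc, SetLike.mem_coe, SetLike.mem_coe,
          Subgroup.mul_mem_cancel_left _ (inv_mem hb)]
      by_cases h : x⁻¹ * y ∈ (iwahori F m : Set (GL (Fin m) F))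
      · rw [Set.indicator_of_mem h, Set.indicator_of_mem (this.2 h)]; rfl
      · rw [Set.indicator_of_notMem h, Set.indicator_of_notMem (fun h' => h (this.1 h'))]
    exact congrArg D this
  have hsm : IsLocallyConstant Φ := by
    refine (IsLocallyConstant.iff_eventually_eq Φ).2 fun x => ?_
    have ht : Filter.Tendsto (fun y : GL (Fin m) F => x⁻¹ * y) (nhds x) (nhds 1) := by
      have := (continuous_const_mul x⁻¹).tendsto x
      rwa [inv_mul_cancel] at this
    filter_upwards [ht (iwahori_mem_nhds m)] with y hy
    have := hB _ hy x
    rwa [mul_inv_cancel_left] at this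
  have hP : ∀ p ∈ borelSubgroup m F, ∀ x, Φ (p * x) = chiDeltaHalf (-z) p * Φ x := by
    intro p hp x
    have : ∀ f : GL (Fin m) F → ℂ, distribution μP Λ (fun y => f (p⁻¹ * y)) =
        chiDeltaHalf (-z) p * distribution μP Λ f := fun f => by
      unfold distribution
      rw [Pchi_left μP z f hp, extendZero_smul _ _ _ (chiDeltaHalf_ne_zero _ hp)]
    rw [← this]
    refine congrArg (distribution μP Λ) (funext fun y => ?_)
    simp only [rightTrans, _root_.mul_inv_rev, mul_assoc]
  ⟨⟨Φ, hsm, hP⟩, fun b hb => Subtype.ext (funext fun x => hB b hb x)⟩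

/-! ### Intertwining operators and the Casselman basis -/

/-- The Bruhat cell `P w P`. -/
def bruhatCell (F : Type*) [NontriviallyNormedField F] {m : ℕ} (w : Equiv.Perm (Fin m)) :
    Set (GL (Fin m) F) :=
  {x | ∃ p ∈ borelSubgroup m F, ∃ q ∈ borelSubgroup m F, x = p * permGL F w * q}

/-- The Bruhat order on the Weyl group: `w < w'` when `P w P` lies in the closure of `P w' P`
and `w ≠ w'`. -/
def bruhatLT (F : Type*) [NontriviallyNormedField F] {m : ℕ} (w w' : Equiv.Perm (Fin m)) : Prop :=
  w ≠ w' ∧ bruhatCell F w ⊆ closure (bruhatCell F w')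

/-- `T` is the intertwining operator `T_w : I(χ) → I(^wχ)`: it is `G`-equivariant, and
`(T φ)(1) = ∫ φ(w⁻¹ n) dn` over `N ∩ w N⁻ w⁻¹` (with the Haar measure that gives the integral
points measure one) when the support of `φ` lies in the union of the cells `P w' P` with
`w' ≮ w⁻¹`. -/
structure IsIntertwining (w : Equiv.Perm (Fin m)) {z : Fin m → ℂ}
    (T : principalSeries (F := F) z →ₗ[ℂ] principalSeries (F := F) (twist w z)) : Prop where
  equivariant : ∀ g φ, T (R g φ) = R g (T φ)
  integral_formula : ∀ ν : Measure (rootSubgroup F w), ν.IsHaarMeasure →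
    ν {u | (u : GL (Fin m) F) ∈ maxCompact F m} = 1 →
    ∀ φ : principalSeries (F := F) z,
      (Function.support (φ : GL (Fin m) F → ℂ) ⊆
        ⋃ w' ∈ {w' : Equiv.Perm (Fin m) | ¬ bruhatLT F w' w⁻¹}, bruhatCell F w') →
      (T φ : GL (Fin m) F → ℂ) 1 =
        ∫ u : rootSubgroup F w,
          (φ : GL (Fin m) F → ℂ) ((permGL F w)⁻¹ * (u : GL (Fin m) F)) ∂ν

/-- The basis `f` of `I(χ)^B` is the Casselman basis: it is dual to the functionals
`φ ↦ (T_w φ)(1)`. -/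
def IsCasselmanBasis {z : Fin m → ℂ}
    (T : ∀ w : Equiv.Perm (Fin m),
      principalSeries (F := F) z →ₗ[ℂ] principalSeries (F := F) (twist w z))
    (f : Module.Basis (Equiv.Perm (Fin m)) ℂ (iwahoriInvariants (F := F) z)) : Prop :=
  ∀ w w' : Equiv.Perm (Fin m),
    (T w (f w' : principalSeries (F := F) z) : GL (Fin m) F → ℂ) 1 = if w = w' then 1 else 0

/-- The coefficients `a_w(g)` in the expansion `R_B R_{g⁻¹} Δ = ∑_w a_w(g) f_w` with respect to a
basis `f` of `I(χ⁻¹)^B`. -/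
def casselmanCoeff [BorelSpace (GL (Fin m) F)] (μP : Measure (borelSubgroup m F))
    [μP.IsHaarMeasure] {z : Fin m → ℂ} (Λ : principalSeries (F := F) z →ₗ[ℂ] ℂ)
    (f : Module.Basis (Equiv.Perm (Fin m)) ℂ (iwahoriInvariants (F := F) (-z)))
    (w : Equiv.Perm (Fin m)) (g : GL (Fin m) F) : ℂ :=
  f.repr (projB μP Λ g) w

end Measure

/-! ### Shalika functionals -/

/-- `Λ` is a Shalika functional on `I(χ)` with respect to the conjugate subgroup `H`:
`Λ(R_h φ) = Ψ_H(h) Λ(φ)`. -/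
def IsShalikaFunctional {n : ℕ} (ψ : AddChar F ℂ) {z : Fin (n + n) → ℂ}
    (Λ : principalSeries (F := F) z →ₗ[ℂ] ℂ) : Prop :=
  ∀ h ∈ conjShalika n F, ∀ φ, Λ (R h φ) = conjShalikaChar ψ h * Λ φ

/-- The set `P · H`. -/
def openOrbit (n : ℕ) (F : Type*) [Field F] : Set (GL (Fin (n + n)) F) :=
  {x | ∃ q : borelSubgroup (n + n) F × conjShalika n F, x = q.1 * q.2}

/-- The function `χ⁻¹ δ^{1/2}(p(x)) Ψ_H⁻¹(h(x))` on `P · H`, where `x = p(x) h(x)`. It does not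
depend on the factorization if `χ = (χ_1, …, χ_n, χ_n⁻¹, …, χ_1⁻¹)`. -/
def openOrbitKernel {n : ℕ} (ψ : AddChar F ℂ) (z : Fin (n + n) → ℂ) (x : GL (Fin (n + n)) F) : ℂ :=
  open Classical in
  if hx : x ∈ openOrbit n F then
    chiDeltaHalf (-z) (hx.choose.1 : GL (Fin (n + n)) F) *
      (conjShalikaChar ψ (hx.choose.2 : GL (Fin (n + n)) F))⁻¹
  else 0

/-- The normalization of the Shalika functional: for test functions `f` supported in `P · H` one
has `Δ_H(f) = ∫_{PH} χ⁻¹ δ^{1/2}(p(x)) f(x) Ψ_H⁻¹(h(x)) dx`. -/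
def IsNormalized {n : ℕ} [MeasurableSpace (GL (Fin (n + n)) F)]
    (μP : Measure (borelSubgroup (n + n) F)) (μG : Measure (GL (Fin (n + n)) F))
    (ψ : AddChar F ℂ) {z : Fin (n + n) → ℂ} (Λ : principalSeries (F := F) z →ₗ[ℂ] ℂ) : Prop :=
  ∀ f : GL (Fin (n + n)) F → ℂ, IsTestFunction f → Function.support f ⊆ openOrbit n F →
    distribution μP Λ f = ∫ x in openOrbit n F, openOrbitKernel ψ z x * f x ∂μG

end LocalField

end Shalika

end

open MeasureTheory Matrix
open scoped NNReal

set_option linter.unusedSectionVars false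

noncomputable section

namespace Shalika

/-! ### Triangular factorizations over a local ring -/

section LocalRing

open IsLocalRing

variable {R : Type*} [CommRing R] [IsLocalRing R]

/-! All the values come from one statement, `apply_rightT_iwahoriT`, about a functional D on test
functions with D(L_p f) = η(p) D(f) for p in P and D(R_h f) = Ψ_H(h) D(f) for h in H, where η is
some character of the form χδ^{1/2}. Let d be diagonal with entries weakly increasing in absolute
value, J = d⁻¹Bd and C = B ∩ J. Then R_{d⁻¹}1_B is the indicator of Bd = dJ, so D(R_{d⁻¹}1_B) = η(d)
D(1_J), and it remains to see that D(1_J) = D(1_B).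

Conjugation by d⁻¹ contracts lower triangular matrices, so the Iwahori factorization gives J =
(d⁻¹(P ∩ K)d)·C. Hence 1_J is a sum of left translates of 1_C by elements of P with unit diagonal,
on which η is 1, and D(1_J) = [J : C] D(1_C). Conversely B = (P ∩ K)(B ∩ H) with P ∩ K contained in
C. Hence 1_B is a sum of right translates of 1_C by elements of B ∩ H, on which Ψ_H is 1, and D(1_B)
= [B : C] D(1_C). The two indices agree because B and J have equal Haar volume (`index_iwahori_eq`).
Uniqueness of Shalika functionals plays no role.

For the values on φ_B one takes D = Δ_H and η = χ⁻¹δ^{1/2}. For the Casselman coefficients one takes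
D'(f) = T_w(x ↦ Δ_H(L_x f))(1), which has the same right equivariance and η = ^wχ⁻¹δ^{1/2}; duality
of the Casselman basis gives a_w(g) = D'(R_g 1_B).

Two inputs need separate work: the factorization of B through P and H (`exists_upper_mul_blocks`),
which is Gaussian elimination over the local ring of integers, and the identification of the modular
character of P with δ (`modularCharacter_borel`), without which 𝒫_χ would not land in I(χ). -/

lemma exists_lower_mul_upper_of_sub_one_mem {n : ℕ} (M : Matrix (Fin n) (Fin n) R)
    (hM : ∀ i j, M i j - (1 : Matrix (Fin n) (Fin n) R) i j ∈ maximalIdeal R) :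
    ∃ L U : Matrix (Fin n) (Fin n) R, (∀ i j, i < j → L i j = 0) ∧ (∀ i j, j < i → U i j = 0) ∧
      M = L * U := by
  induction n with
  | zero => exact ⟨1, 1, fun i => i.elim0, fun i => i.elim0, Subsingleton.elim _ _⟩
  | succ n ih =>
    have ha : IsUnit (M 0 0) := by
      have h := hM 0 0
      rw [one_apply_eq] at h
      by_contra hu
      have h1 := (maximalIdeal R).sub_mem ((mem_maximalIdeal _).2 hu) h
      rw [sub_sub_cancel] at h1
      exact (mem_maximalIdeal _).1 h1 isUnit_one
    obtain ⟨a, ha⟩ := ha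
    have hr : ∀ j : Fin n, M 0 j.succ ∈ maximalIdeal R := fun j => by
      have h := hM 0 j.succ
      rwa [one_apply_ne (Fin.succ_ne_zero j).symm, sub_zero] at h
    -- The induction runs on the Schur complement of the unit pivot. It is still congruent to the
    -- identity because the rest of the first row lies in the maximal ideal.
    obtain ⟨L, U, hL, hU, hLU⟩ := ih
      (of fun i j => M i.succ j.succ - M i.succ 0 * ((a⁻¹ : Rˣ) * M 0 j.succ)) fun i j => by
        have h1 := hM i.succ j.succ
        have h2 : M i.succ 0 * ((a⁻¹ : Rˣ) * M 0 j.succ) ∈ maximalIdeal R :=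
          Ideal.mul_mem_left _ _ (Ideal.mul_mem_left _ _ (hr j))
        have h3 := (maximalIdeal R).sub_mem h1 h2
        have h4 : (1 : Matrix (Fin (n + 1)) (Fin (n + 1)) R) i.succ j.succ =
            (1 : Matrix (Fin n) (Fin n) R) i j := by simp [Matrix.one_apply]
        rw [h4] at h3
        simpa only [of_apply, sub_right_comm] using h3
    refine ⟨of fun i j => Fin.cases (Fin.cases (a : R) (fun _ => 0) j)
      (fun i' => Fin.cases (M i'.succ 0) (fun j' => L i' j') j) i,
      of fun i j => Fin.cases (Fin.cases 1 (fun j' => (a⁻¹ : Rˣ) * M 0 j'.succ) j)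
      (fun i' => Fin.cases 0 (fun j' => U i' j') j) i, ?_, ?_, ?_⟩
    · intro i j hij
      induction i using Fin.cases <;> induction j using Fin.cases
      · exact absurd hij (lt_irrefl _)
      · rfl
      · exact absurd hij (Fin.not_lt_zero _)
      · exact hL _ _ (Fin.succ_lt_succ_iff.1 hij)
    · intro i j hij
      induction i using Fin.cases <;> induction j using Fin.cases
      · exact absurd hij (lt_irrefl _)
      · exact absurd hij (Fin.not_lt_zero _)
      · rfl
      · exact hU _ _ (Fin.succ_lt_succ_iff.1 hij)
    · ext i j
      rw [mul_apply, Fin.sum_univ_succ]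
      induction i using Fin.cases with
      | zero =>
        induction j using Fin.cases with
        | zero => simp [ha]
        | succ j => simp
      | succ i =>
        induction j using Fin.cases with
        | zero => simp
        | succ j =>
          have h := congrFun (congrFun hLU i) j
          rw [of_apply, mul_apply, sub_eq_iff_eq_add] at h
          simp [h, add_comm]

lemma map_residue_apply {n : ℕ} (g : GL (Fin n) R) (i j : Fin n) :
    GeneralLinearGroup.map (residue R) g i j = residue R (g i j) := rfl

lemma isUnit_det_iff_of_upper {n : ℕ} {M : Matrix (Fin n) (Fin n) R}
    (hM : ∀ i j, j < i → M i j ∈ maximalIdeal R) : IsUnit M.det ↔ ∀ i, IsUnit (M i i) := by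
  have h : residue R M.det = ∏ i, residue R (M i i) := by
    rw [RingHom.map_det]
    exact det_of_isUpperTriangular fun i j hij => (IsLocalRing.residue_eq_zero_iff _).2 (hM i j hij)
  simp only [← isUnit_map_iff (residue R), h, isUnit_iff_ne_zero, Finset.prod_ne_zero_iff,
    Finset.mem_univ, true_imp_iff]

lemma isUnit_det_iff_of_lower {n : ℕ} {M : Matrix (Fin n) (Fin n) R}
    (hM : ∀ i j, i < j → M i j ∈ maximalIdeal R) : IsUnit M.det ↔ ∀ i, IsUnit (M i i) := by
  rw [← det_transpose]
  exact isUnit_det_iff_of_upper (M := Mᵀ) fun i j hij => hM j i hij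

/-- A matrix that is upper triangular modulo the maximal ideal is congruent to an upper triangular
one. -/
lemma exists_upper_residue_eq {n : ℕ} (C : GL (Fin n) R)
    (hC : ∀ i j, j < i → C i j ∈ maximalIdeal R) :
    ∃ U : GL (Fin n) R, (∀ i j, j < i → U i j = 0) ∧
      GeneralLinearGroup.map (residue R) U = GeneralLinearGroup.map (residue R) C := by
  let U : Matrix (Fin n) (Fin n) R := of fun i j => if j < i then 0 else C i j
  have h0 : ∀ i j, j < i → U i j = 0 := fun i j hij => if_pos hij
  have hU : IsUnit U.det := by
    rw [isUnit_det_iff_of_upper fun i j hij => by rw [h0 i j hij]; exact zero_mem _]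
    have h := (isUnit_det_iff_of_upper hC).1 ((isUnit_iff_isUnit_det _).1 C.isUnit)
    intro i
    simpa [U] using h i
  refine ⟨GeneralLinearGroup.mk'' U hU, h0, ?_⟩
  ext i j
  rw [map_residue_apply, map_residue_apply]
  by_cases hij : j < i
  · rw [(IsLocalRing.residue_eq_zero_iff _).2 (hC i j hij)]
    exact (congrArg (residue R) (h0 i j hij)).trans (map_zero _)
  · exact congrArg (residue R) (if_neg hij)

lemma exists_lower_residue_eq {n : ℕ} (A : GL (Fin n) R)
    (hA : ∀ i j, i < j → A i j ∈ maximalIdeal R) :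
    ∃ L : GL (Fin n) R, (∀ i j, i < j → L i j = 0) ∧
      GeneralLinearGroup.map (residue R) L = GeneralLinearGroup.map (residue R) A := by
  let L : Matrix (Fin n) (Fin n) R := of fun i j => if i < j then 0 else A i j
  have h0 : ∀ i j, i < j → L i j = 0 := fun i j hij => if_pos hij
  have hL : IsUnit L.det := by
    rw [isUnit_det_iff_of_lower fun i j hij => by rw [h0 i j hij]; exact zero_mem _]
    have h := (isUnit_det_iff_of_lower hA).1 ((isUnit_iff_isUnit_det _).1 A.isUnit)
    intro i
    simpa [L] using h i
  refine ⟨GeneralLinearGroup.mk'' L hL, h0, ?_⟩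
  ext i j
  rw [map_residue_apply, map_residue_apply]
  by_cases hij : i < j
  · rw [(IsLocalRing.residue_eq_zero_iff _).2 (hA i j hij)]
    exact (congrArg (residue R) (h0 i j hij)).trans (map_zero _)
  · exact congrArg (residue R) (if_neg hij)

lemma lower_mul {n : ℕ} {k : Type*} [CommRing k] {A B : Matrix (Fin n) (Fin n) k}
    (hA : ∀ i j, i < j → A i j = 0) (hB : ∀ i j, i < j → B i j = 0) :
    ∀ i j, i < j → (A * B) i j = 0 := by
  intro i j hij
  rw [mul_apply]
  refine Finset.sum_eq_zero fun l _ => ?_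
  rcases lt_or_ge i l with h | h
  · rw [hA i l h, zero_mul]
  · rw [hB l j (h.trans_lt hij), mul_zero]

lemma upper_mul {n : ℕ} {k : Type*} [CommRing k] {A B : Matrix (Fin n) (Fin n) k}
    (hA : ∀ i j, j < i → A i j = 0) (hB : ∀ i j, j < i → B i j = 0) :
    ∀ i j, j < i → (A * B) i j = 0 := by
  intro i j hij
  rw [mul_apply]
  refine Finset.sum_eq_zero fun l _ => ?_
  rcases lt_or_ge l i with h | h
  · rw [hA i l h, zero_mul]
  · rw [hB l j (hij.trans_le h), mul_zero]

lemma upper_inv {n : ℕ} {k : Type*} [CommRing k] {a : GL (Fin n) k}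
    (ha : ∀ i j, j < i → a i j = 0) : ∀ i j, j < i → (a⁻¹ : GL (Fin n) k) i j = 0 := by
  let _ : Invertible a.val := a.invertible
  have h := blockTriangular_inv_of_blockTriangular (M := a.val) (b := (id : Fin n → Fin n))
    (fun i j h => ha i j h)
  intro i j hij
  have := h hij
  rwa [← Matrix.coe_units_inv] at this

/-- A product of a matrix that is lower triangular modulo the maximal ideal and of one that is
upper triangular modulo the maximal ideal is the product of a lower triangular and an upper
triangular matrix. -/
lemma exists_lower_mul_upper {n : ℕ} {A C : GL (Fin n) R}
    (hA : ∀ i j, i < j → A i j ∈ maximalIdeal R) (hC : ∀ i j, j < i → C i j ∈ maximalIdeal R) :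
    ∃ L U : GL (Fin n) R, (∀ i j, i < j → L i j = 0) ∧ (∀ i j, j < i → U i j = 0) ∧
      A * C = L * U := by
  obtain ⟨L₀, hL₀, hLA⟩ := exists_lower_residue_eq A hA
  obtain ⟨U₀, hU₀, hUC⟩ := exists_upper_residue_eq C hC
  -- Removing triangular lifts of the residues of `A` and `C` leaves a matrix congruent to the
  -- identity.
  let M : GL (Fin n) R := L₀⁻¹ * A * (C * U₀⁻¹)
  have hM : GeneralLinearGroup.map (residue R) M = 1 := by
    simp only [M, map_mul, map_inv, hLA, hUC]
    simp
  obtain ⟨L₁, U₁, hL₁, hU₁, h⟩ := exists_lower_mul_upper_of_sub_one_mem M.val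
    fun i j => by
      rw [← IsLocalRing.residue_eq_zero_iff, map_sub, ← map_residue_apply, hM, sub_eq_zero]
      simp [one_apply, apply_ite (residue R)]
  have hdet : IsUnit (L₁.det * U₁.det) := by
    rw [← det_mul, ← h]
    exact (isUnit_iff_isUnit_det _).1 M.isUnit
  refine ⟨L₀ * GeneralLinearGroup.mk'' L₁ (isUnit_of_mul_isUnit_left hdet),
    GeneralLinearGroup.mk'' U₁ (isUnit_of_mul_isUnit_right hdet) * U₀, lower_mul hL₀ hL₁,
    upper_mul hU₁ hU₀, ?_⟩
  have h' : M = GeneralLinearGroup.mk'' L₁ (isUnit_of_mul_isUnit_left hdet) *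
    GeneralLinearGroup.mk'' U₁ (isUnit_of_mul_isUnit_right hdet) := Units.ext h
  calc A * C = L₀ * M * U₀ := by simp only [M]; group
    _ = _ := by rw [h']; group

/-- Conjugation of an invertible matrix by the antidiagonal permutation matrix. -/
def revConj {n : ℕ} {k : Type*} [CommRing k] : GL (Fin n) k ≃* GL (Fin n) k :=
  Units.mapEquiv (reindexAlgEquiv k k (Fin.revPerm : Equiv.Perm (Fin n))).toMulEquiv

lemma revConj_apply {n : ℕ} {k : Type*} [CommRing k] (g : GL (Fin n) k) (i j : Fin n) :
    revConj g i j = g i.rev j.rev := rfl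

/-- Needed over a ring, since the factorizations take place over the ring of integers. -/
lemma blocks_mul' {n : ℕ} {k : Type*} [CommRing k] (A B C D A' B' C' D' : Matrix (Fin n) (Fin n) k) :
    blocks A B C D * blocks A' B' C' D' =
      blocks (A * A' + B * C') (A * B' + B * D') (C * A' + D * C') (C * B' + D * D') := by
  simp only [blocks, Matrix.reindex_apply, Matrix.submatrix_mul_equiv, Matrix.fromBlocks_multiply]

section Blocks

variable {n : ℕ} {k : Type*} (A B C D : Matrix (Fin n) (Fin n) k) (i j : Fin n)

@[simp] lemma blocks_apply₁₁ : blocks A B C D (Fin.castAdd n i) (Fin.castAdd n j) = A i j := by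
  simp only [blocks, reindex_apply, submatrix_apply, finSumFinEquiv_symm_apply_castAdd,
    fromBlocks_apply₁₁]

@[simp] lemma blocks_apply₁₂ : blocks A B C D (Fin.castAdd n i) (Fin.natAdd n j) = B i j := by
  simp only [blocks, reindex_apply, submatrix_apply, finSumFinEquiv_symm_apply_castAdd,
    finSumFinEquiv_symm_apply_natAdd, fromBlocks_apply₁₂]

@[simp] lemma blocks_apply₂₁ : blocks A B C D (Fin.natAdd n i) (Fin.castAdd n j) = C i j := by
  simp only [blocks, reindex_apply, submatrix_apply, finSumFinEquiv_symm_apply_castAdd,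
    finSumFinEquiv_symm_apply_natAdd, fromBlocks_apply₂₁]

@[simp] lemma blocks_apply₂₂ : blocks A B C D (Fin.natAdd n i) (Fin.natAdd n j) = D i j := by
  simp only [blocks, reindex_apply, submatrix_apply, finSumFinEquiv_symm_apply_natAdd,
    fromBlocks_apply₂₂]

lemma eq_blocks (M : Matrix (Fin (n + n)) (Fin (n + n)) k) :
    M = blocks (M.submatrix (Fin.castAdd n) (Fin.castAdd n))
      (M.submatrix (Fin.castAdd n) (Fin.natAdd n)) (M.submatrix (Fin.natAdd n) (Fin.castAdd n))
      (M.submatrix (Fin.natAdd n) (Fin.natAdd n)) := by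
  ext i j
  refine Fin.addCases (fun i => ?_) (fun i => ?_) i <;>
    refine Fin.addCases (fun j => ?_) (fun j => ?_) j <;>
    simp only [blocks_apply₁₁, blocks_apply₁₂, blocks_apply₂₁, blocks_apply₂₂, submatrix_apply]

end Blocks

lemma upper_blocks {n : ℕ} {k : Type*} [Zero k] {A B D : Matrix (Fin n) (Fin n) k}
    (hA : ∀ i j, j < i → A i j = 0) (hD : ∀ i j, j < i → D i j = 0) :
    ∀ i j, j < i → blocks A B 0 D i j = 0 := by
  intro i j
  refine Fin.addCases (fun i => ?_) (fun i => ?_) i <;>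
    refine Fin.addCases (fun j => ?_) (fun j => ?_) j <;> intro hij
  · rw [blocks_apply₁₁]
    exact hA i j hij
  · exact absurd hij (by simp only [Fin.lt_def, Fin.val_natAdd, Fin.val_castAdd]; omega)
  · rw [blocks_apply₂₁]
    rfl
  · rw [blocks_apply₂₂]
    exact hD i j (Nat.add_lt_add_iff_left.1 hij)

/-- An invertible matrix that is upper triangular modulo the maximal ideal is the product of an
upper triangular matrix and of an element of the conjugate Shalika subgroup. -/
lemma exists_upper_mul_blocks {n : ℕ} (b : GL (Fin (n + n)) R)
    (hb : ∀ i j, j < i → b i j ∈ maximalIdeal R) :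
    ∃ (p : GL (Fin (n + n)) R) (g : GL (Fin n) R) (Y : Matrix (Fin n) (Fin n) R),
      (∀ i j, j < i → p i j = 0) ∧
      (b : Matrix (Fin (n + n)) (Fin (n + n)) R) = p * blocks g 0 Y (revConj g).val := by
  have hdiag := (isUnit_det_iff_of_upper hb).1 ((isUnit_iff_isUnit_det _).1 b.isUnit)
  let b₁₁ : Matrix (Fin n) (Fin n) R := b.val.submatrix (Fin.castAdd n) (Fin.castAdd n)
  let b₁₂ : Matrix (Fin n) (Fin n) R := b.val.submatrix (Fin.castAdd n) (Fin.natAdd n)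
  let b₂₁ : Matrix (Fin n) (Fin n) R := b.val.submatrix (Fin.natAdd n) (Fin.castAdd n)
  have hb₂₁ : ∀ i j, b₂₁ i j ∈ maximalIdeal R := fun i j =>
    hb _ _ (by simp only [Fin.lt_def, Fin.val_natAdd, Fin.val_castAdd]; omega)
  have hb₂₂ : ∀ i j, j < i → b.val.submatrix (Fin.natAdd n) (Fin.natAdd n) i j ∈ maximalIdeal R :=
    fun i j hij => hb _ _ (Nat.add_lt_add_left hij n)
  let b₂₂ : GL (Fin n) R := GeneralLinearGroup.mk''
    (b.val.submatrix (Fin.natAdd n) (Fin.natAdd n))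
    ((isUnit_det_iff_of_upper hb₂₂).2 fun i => hdiag (Fin.natAdd n i))
  have hB : b.val = blocks b₁₁ b₁₂ b₂₁ b₂₂.val := eq_blocks _
  have hX : ∀ i j, (b₁₂ * (b₂₂⁻¹).val * b₂₁) i j ∈ maximalIdeal R := fun i j => by
    rw [mul_apply]
    exact Ideal.sum_mem _ fun l _ => Ideal.mul_mem_left _ _ (hb₂₁ l j)
  have hs' : ∀ i j, j < i → (b₁₁ - b₁₂ * (b₂₂⁻¹).val * b₂₁) i j ∈ maximalIdeal R := fun i j hij =>
    (maximalIdeal R).sub_mem (hb _ _ hij) (hX i j)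
  -- The Schur complement of `b₂₂`. It differs from `b₁₁` by entries of the maximal ideal, so its
  -- diagonal still consists of units.
  let s : GL (Fin n) R := GeneralLinearGroup.mk'' (b₁₁ - b₁₂ * (b₂₂⁻¹).val * b₂₁)
    ((isUnit_det_iff_of_upper hs').2 fun i => by
      by_contra hu
      have h1 := (maximalIdeal R).add_mem ((mem_maximalIdeal _).2 hu) (hX i i)
      rw [Matrix.sub_apply, sub_add_cancel] at h1
      exact (mem_maximalIdeal _).1 h1 (hdiag (Fin.castAdd n i)))
  have hs : ∀ i j, j < i → s⁻¹ i j ∈ maximalIdeal R := by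
    have h : GeneralLinearGroup.map (residue R) s ∈ borelSubgroup n (ResidueField R) :=
      fun i j hij => (IsLocalRing.residue_eq_zero_iff _).2 (hs' i j hij)
    have h' := inv_mem h
    rw [← map_inv] at h'
    exact fun i j hij => (IsLocalRing.residue_eq_zero_iff _).1 (h' i j hij)
  -- If `p` has diagonal blocks `U⁻¹` and `revConj L`, comparison of blocks demands `U⁻¹ * g = s`
  -- and `revConj L * revConj g = b₂₂`. Eliminating `g` leaves `revConj b₂₂ * s⁻¹ = L * U`, a
  -- lower-upper factorization because reversal exchanges the two kinds of triangularity.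
  obtain ⟨L, U, hL, hU, hLU⟩ := exists_lower_mul_upper (A := revConj b₂₂) (C := s⁻¹)
    (fun i j hij => hb₂₂ _ _ (Fin.rev_lt_rev.2 hij)) hs
  let g : GL (Fin n) R := U * s
  have hg : revConj L * revConj g = b₂₂ := by
    rw [← map_mul, ← mul_assoc, ← hLU, inv_mul_cancel_right]
    exact Units.ext (by ext i j; simp [revConj_apply])
  let P : Matrix (Fin (n + n)) (Fin (n + n)) R :=
    blocks (U⁻¹).val (b₁₂ * ((revConj g)⁻¹).val) 0 (revConj L).val
  have hP : IsUnit P.det := by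
    change IsUnit (reindex _ _ _).det
    rw [det_reindex_self, det_fromBlocks_zero₂₁]
    exact ((isUnit_iff_isUnit_det _).1 (U⁻¹).isUnit).mul
      ((isUnit_iff_isUnit_det _).1 (revConj L).isUnit)
  refine ⟨GeneralLinearGroup.mk'' P hP, g, ((revConj L)⁻¹).val * b₂₁,
    upper_blocks (upper_inv hU) fun i j hij => hL _ _ (Fin.rev_lt_rev.2 hij), ?_⟩
  have h1 : (U⁻¹).val * g.val = s.val := by
    rw [← Units.val_mul, inv_mul_cancel_left]
  have h2 : ((revConj g)⁻¹).val * ((revConj L)⁻¹).val = (b₂₂⁻¹).val := by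
    rw [← Units.val_mul, ← _root_.mul_inv_rev, hg]
  have h3 : b₁₁ = s.val + b₁₂ * (b₂₂⁻¹).val * b₂₁ := (sub_add_cancel _ _).symm
  change b.val = P * _
  rw [hB, blocks_mul', h1, mul_assoc b₁₂ ((revConj g)⁻¹).val, ← mul_assoc ((revConj g)⁻¹).val, h2,
    ← mul_assoc, ← h3, mul_assoc b₁₂, Units.inv_mul, ← mul_assoc, Units.mul_inv,
    ← Units.val_mul (revConj L), hg]
  simp

end LocalRing

/-! ### Diagonal matrices -/

section Diagonal

variable {m : ℕ} {k : Type*} [Field k]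

/-- The diagonal matrices in `GL_m(k)`. -/
def diagGL : (Fin m → kˣ) →* GL (Fin m) k :=
  (Units.map (Matrix.diagonalRingHom (Fin m) k).toMonoidHom).comp
    (MulEquiv.piUnits (M := fun _ : Fin m => k)).symm.toMonoidHom

lemma diagGL_val (d : Fin m → kˣ) :
    (diagGL d : Matrix (Fin m) (Fin m) k) = diagonal fun i => (d i : k) := rfl

lemma diagGL_apply_self (d : Fin m → kˣ) (i : Fin m) : diagGL d i i = d i := by
  rw [diagGL_val, diagonal_apply_eq]

lemma diagGL_mem_borel (d : Fin m → kˣ) : diagGL d ∈ borelSubgroup m k := fun i j hij => by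
  rw [diagGL_val, diagonal_apply_ne _ hij.ne']

lemma diagGL_conj_apply (d : Fin m → kˣ) (x : GL (Fin m) k) (i j : Fin m) :
    (diagGL d * x * (diagGL d)⁻¹) i j = d i * x i j * (d j : k)⁻¹ := by
  rw [← map_inv, GeneralLinearGroup.coe_mul, GeneralLinearGroup.coe_mul, diagGL_val, diagGL_val,
    mul_diagonal, diagonal_mul, Pi.inv_apply, Units.val_inv_eq_inv_val]

lemma diagGL_conj_apply' (d : Fin m → kˣ) (x : GL (Fin m) k) (i j : Fin m) :
    ((diagGL d)⁻¹ * x * diagGL d) i j = (d i : k)⁻¹ * x i j * d j := by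
  have h := diagGL_conj_apply d⁻¹ x i j
  rw [map_inv, inv_inv] at h
  rw [h]
  simp

lemma permGL_conj_diagGL (w : Equiv.Perm (Fin m)) (d : Fin m → kˣ) :
    permGL k w * diagGL d * (permGL k w)⁻¹ = diagGL fun i => d (w⁻¹ i) := by
  rw [mul_inv_eq_iff_eq_mul]
  ext i j
  simp only [GeneralLinearGroup.coe_mul, diagGL_val, mul_diagonal, diagonal_mul]
  by_cases h : w⁻¹ i = j
  · rw [h, mul_comm]
  · have : permGL k w i j = 0 := by
      change ((Equiv.toPEquiv w⁻¹).toMatrix : Matrix (Fin m) (Fin m) k) i j = 0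
      rw [PEquiv.toMatrix_apply, if_neg]
      exact fun h' => h (by simpa using h')
    rw [this, zero_mul, mul_zero]

lemma gLam_eq_diagGL {n : ℕ} (ϖ : kˣ) (l : Fin n → ℤ) :
    gLam ϖ l = diagGL (Fin.append (fun i => ϖ ^ l i) (fun _ => 1)) := rfl

lemma gLam_neg {n : ℕ} (ϖ : kˣ) (l : Fin n → ℤ) : gLam ϖ (-l) = (gLam ϖ l)⁻¹ := by
  rw [gLam_eq_diagGL, gLam_eq_diagGL, ← map_inv]
  congr 1
  ext i
  refine Fin.addCases (fun i => ?_) (fun i => ?_) i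
  · simp
  · rw [Pi.inv_apply, Fin.append_right, Fin.append_right, inv_one]

lemma gLam_zero {n : ℕ} (ϖ : kˣ) : gLam ϖ (0 : Fin n → ℤ) = 1 := by
  rw [gLam_eq_diagGL, ← map_one diagGL]
  congr 1
  ext i
  refine Fin.addCases (fun i => ?_) (fun i => ?_) i
  · simp
  · rw [Fin.append_right, Pi.one_apply]

end Diagonal

/-! ### The conjugate Shalika subgroup -/

section ConjShalika

variable {n : ℕ} {k : Type*} [Field k]

lemma antidiag_mul_mul (A : Matrix (Fin n) (Fin n) k) :
    antidiag n k * A * antidiag n k = A.submatrix Fin.rev Fin.rev := by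
  ext i j
  rw [mul_apply, Finset.sum_eq_single j.rev, mul_apply, Finset.sum_eq_single i.rev]
  · simp [antidiag]
  · intro l _ hl
    simp [antidiag, hl]
  · simp
  · intro l _ hl
    simp [antidiag, ← Fin.rev_eq_iff, Ne.symm hl]
  · simp

lemma xi_conj_val {h : GL (Fin (n + n)) k} {g Y D : Matrix (Fin n) (Fin n) k}
    (hh : h.val = blocks g 0 Y D) :
    ((xi n k)⁻¹ * h * xi n k).val = blocks (antidiag n k * D * antidiag n k) (antidiag n k * Y) 0 g := by
  have h1 : ((xi n k)⁻¹).val = blocks 0 (antidiag n k) 1 0 := rfl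
  have h2 : (xi n k).val = blocks 0 1 (antidiag n k) 0 := rfl
  rw [Units.val_mul, Units.val_mul, h1, h2, hh, blocks_mul, blocks_mul]
  simp

/-- Conjugation by `xi` moves the unipotent part below the diagonal, with `Y = w₀ g X`. In this form
`H` can be compared with upper triangular matrices block by block. -/
lemma mem_conjShalika_iff (h : GL (Fin (n + n)) k) :
    h ∈ conjShalika n k ↔ ∃ (g : GL (Fin n) k) (Y : Matrix (Fin n) (Fin n) k),
      h.val = blocks g.val 0 Y (revConj g).val := by
  have hrev : ∀ g : GL (Fin n) k, (revConj g).val = antidiag n k * g.val * antidiag n k :=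
    fun g => (antidiag_mul_mul _).symm
  constructor
  · rintro ⟨s, ⟨g, X, hs⟩, rfl⟩
    refine ⟨g, antidiag n k * (g.val * X), ?_⟩
    have h1 : ((xi n k)⁻¹).val = blocks 0 (antidiag n k) 1 0 := rfl
    have h2 : (xi n k).val = blocks 0 1 (antidiag n k) 0 := rfl
    change (xi n k * s * (xi n k)⁻¹).val = _
    rw [Units.val_mul, Units.val_mul, h1, h2, hs, blocks_mul, blocks_mul, blocks_mul, hrev]
    simp
  · rintro ⟨g, Y, hh⟩
    refine ⟨(xi n k)⁻¹ * h * xi n k, ⟨g, (g⁻¹).val * (antidiag n k * Y), ?_⟩, ?_⟩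
    · rw [xi_conj_val hh, hrev, blocks_mul, ← mul_assoc, ← mul_assoc, antidiag_mul_self, one_mul,
        mul_assoc, antidiag_mul_self, mul_one, ← mul_assoc g.val, Units.mul_inv]
      simp
    · change xi n k * ((xi n k)⁻¹ * h * xi n k) * (xi n k)⁻¹ = h
      group

lemma conjShalikaChar_eq (ψ : AddChar k ℂ) {h : GL (Fin (n + n)) k} {g : GL (Fin n) k}
    {Y : Matrix (Fin n) (Fin n) k} (hh : h.val = blocks g.val 0 Y (revConj g).val) :
    conjShalikaChar ψ h = ψ (trace ((g⁻¹).val * (antidiag n k * Y))) := by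
  have hrev : (revConj g).val = antidiag n k * g.val * antidiag n k := (antidiag_mul_mul _).symm
  unfold conjShalikaChar shalikaChar
  rw [xi_conj_val hh, hrev, ← mul_assoc, ← mul_assoc, antidiag_mul_self, one_mul,
        mul_assoc, antidiag_mul_self, mul_one]
  simp [blocks]

/-- An upper triangular element of the conjugate Shalika subgroup is block diagonal. -/
lemma exists_of_mem_borel_of_mem_conjShalika {t : GL (Fin (n + n)) k}
    (ht : t ∈ borelSubgroup (n + n) k) (ht' : t ∈ conjShalika n k) :
    ∃ d : GL (Fin n) k, t.val = blocks d.val 0 0 (revConj d).val := by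
  obtain ⟨d, Y, h⟩ := (mem_conjShalika_iff t).1 ht'
  refine ⟨d, ?_⟩
  have hY : Y = 0 := by
    ext i j
    have := ht (Fin.natAdd n i) (Fin.castAdd n j)
      (by simp only [Fin.lt_def, Fin.val_natAdd, Fin.val_castAdd]; omega)
    rwa [h, blocks_apply₂₁] at this
  rw [h, hY]

/-- An element of P ∩ H with upper block `d` replaces `g` by `d g` and `Y` by `w₀ d w₀ Y`, so that
`g⁻¹ w₀ Y` is unchanged. Hence Ψ_H(h) depends only on the product x = ph. -/
lemma conjShalikaChar_borel_mul (ψ : AddChar k ℂ) {t h : GL (Fin (n + n)) k}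
    (ht : t ∈ borelSubgroup (n + n) k) (ht' : t ∈ conjShalika n k) (hh : h ∈ conjShalika n k) :
    conjShalikaChar ψ (t * h) = conjShalikaChar ψ h := by
  obtain ⟨d, hd⟩ := exists_of_mem_borel_of_mem_conjShalika ht ht'
  obtain ⟨g, Y, hg⟩ := (mem_conjShalika_iff h).1 hh
  have hrev : (revConj d).val = antidiag n k * d.val * antidiag n k := (antidiag_mul_mul _).symm
  have hth : (t * h).val = blocks (d * g).val 0 ((revConj d).val * Y) (revConj (d * g)).val := by
    rw [Units.val_mul, hd, hg, blocks_mul, map_mul]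
    simp
  rw [conjShalikaChar_eq ψ hth, conjShalikaChar_eq ψ hg, hrev, _root_.mul_inv_rev, Units.val_mul]
  congr 2
  rw [mul_assoc (antidiag n k * d.val), mul_assoc (antidiag n k), ← mul_assoc (antidiag n k) (antidiag n k),
    antidiag_mul_self, one_mul, mul_assoc, ← mul_assoc (d⁻¹).val, Units.inv_mul, one_mul]

/-- This symmetry of the diagonal forces characters with exponents antisymmetric under reversal,
such as χ and δ, to be trivial on P ∩ H. -/
lemma apply_rev_of_mem_borel_of_mem_conjShalika {t : GL (Fin (n + n)) k}
    (ht : t ∈ borelSubgroup (n + n) k) (ht' : t ∈ conjShalika n k) (i : Fin (n + n)) :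
    t i.rev i.rev = t i i := by
  obtain ⟨d, hd⟩ := exists_of_mem_borel_of_mem_conjShalika ht ht'
  have h1 : ∀ i : Fin n, t (Fin.castAdd n i).rev (Fin.castAdd n i).rev =
      t (Fin.castAdd n i) (Fin.castAdd n i) := fun i => by
    have : (Fin.castAdd n i).rev = Fin.natAdd n i.rev := by
      ext; simp only [Fin.val_rev, Fin.val_castAdd, Fin.val_natAdd]; omega
    rw [this, hd, blocks_apply₂₂, blocks_apply₁₁, revConj_apply, Fin.rev_rev]
  refine Fin.addCases h1 (fun i => ?_) i
  have : Fin.natAdd n i = (Fin.castAdd n i.rev).rev := by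
    ext; simp only [Fin.val_rev, Fin.val_castAdd, Fin.val_natAdd]; omega
  rw [this, Fin.rev_rev, h1]

end ConjShalika

variable {F : Type*} [NontriviallyNormedField F] [IsUltrametricDist F]

/-! ### Topology of the compact subgroups -/

section Topology

variable {m : ℕ}

lemma continuous_apply_GL (i j : Fin m) : Continuous fun g : GL (Fin m) F => g i j :=
  Units.continuous_val.matrix_elem i j

lemma isOpen_iwahori : IsOpen (iwahori F m : Set (GL (Fin m) F)) :=
  Subgroup.isOpen_of_mem_nhds _ (iwahori_mem_nhds m)

lemma iwahori_le_maxCompact : iwahori F m ≤ maxCompact F m := fun g hg =>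
  ((mem_iwahori_iff g).1 hg).1

lemma isOpen_maxCompact : IsOpen (maxCompact F m : Set (GL (Fin m) F)) :=
  Subgroup.isOpen_mono iwahori_le_maxCompact isOpen_iwahori

lemma isClosed_borelSubgroup : IsClosed (borelSubgroup m F : Set (GL (Fin m) F)) := by
  have : (borelSubgroup m F : Set (GL (Fin m) F)) = ⋂ i, ⋂ j, {g | j < i → g i j = 0} := by
    ext g; simp [borelSubgroup]
  rw [this]
  refine isClosed_iInter fun i => isClosed_iInter fun j => ?_
  by_cases h : j < i
  · simpa [h] using isClosed_eq (continuous_apply_GL i j) continuous_const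
  · simp [h]

variable [LocallyCompactSpace F]

/-- The map g ↦ (g, g⁻¹) is a closed embedding, and K is the preimage of a product of closed unit
balls, which are compact. -/
lemma isCompact_maxCompact : IsCompact (maxCompact F m : Set (GL (Fin m) F)) := by
  have : ProperSpace F := .of_locallyCompactSpace F
  let S : Set (Matrix (Fin m) (Fin m) F) :=
    Set.univ.pi fun _ => Set.univ.pi fun _ => Metric.closedBall 0 1
  have hS : IsCompact S :=
    isCompact_univ_pi fun _ => isCompact_univ_pi fun _ => isCompact_closedBall _ _
  have h := (Units.isClosedEmbedding_embedProduct (α := Matrix (Fin m) (Fin m) F)).isCompact_preimage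
    (hS.prod (MulOpposite.opHomeomorph.symm.isCompact_preimage.mpr hS))
  convert h using 1
  ext g
  rw [SetLike.mem_coe, mem_maxCompact_iff]
  change _ ↔ g.val ∈ S ∧ (g⁻¹).val ∈ S
  have hmem : ∀ M : Matrix (Fin m) (Fin m) F, M ∈ S ↔ ∀ i j, ‖M i j‖ ≤ 1 := fun M =>
    ⟨fun h i j => mem_closedBall_zero_iff.1 (h i trivial j trivial),
      fun h i _ j _ => mem_closedBall_zero_iff.2 (h i j)⟩
  simp only [hmem, forall_and]

lemma isCompact_iwahori : IsCompact (iwahori F m : Set (GL (Fin m) F)) :=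
  isCompact_maxCompact.of_isClosed_subset (Subgroup.isClosed_of_isOpen _ isOpen_iwahori)
    iwahori_le_maxCompact

instance : LocallyCompactSpace (Matrix (Fin m) (Fin m) F) :=
  inferInstanceAs (LocallyCompactSpace (Fin m → Fin m → F))

instance : LocallyCompactSpace (borelSubgroup m F) :=
  isClosed_borelSubgroup.locallyCompactSpace

end Topology

/-! ### Factorizations of the Iwahori subgroup -/

section Iwahori

lemma exists_map_of_mem_iwahori {m : ℕ} {b : GL (Fin m) F} (hb : b ∈ iwahori F m) :
    ∃ u : GL (Fin m) (integers F), (∀ i j, j < i → u i j ∈ IsLocalRing.maximalIdeal (integers F)) ∧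
      GeneralLinearGroup.map (integers F).subtype u = b := by
  obtain ⟨u, hu, rfl⟩ := hb
  exact ⟨u, fun i j hij => (IsLocalRing.residue_eq_zero_iff _).1 (hu i j hij), rfl⟩

lemma map_mem_borel {m : ℕ} {u : GL (Fin m) (integers F)} (hu : ∀ i j, j < i → u i j = 0) :
    GeneralLinearGroup.map (integers F).subtype u ∈ borelSubgroup m F := fun i j hij =>
  congrArg Subtype.val (hu i j hij)

lemma mem_iwahori_of_mem_borel {m : ℕ} {p : GL (Fin m) F} (hp : p ∈ borelSubgroup m F)
    (hp' : p ∈ maxCompact F m) : p ∈ iwahori F m :=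
  (mem_iwahori_iff p).2 ⟨hp', fun i j hij => by rw [hp i j hij, norm_zero]; exact one_pos⟩

/-- The Iwahori factorization `B = (P ∩ K) (B ∩ P⁻)`, with `P⁻` the lower triangular matrices. -/
lemma exists_borel_mul_lower {m : ℕ} {b : GL (Fin m) F} (hb : b ∈ iwahori F m) :
    ∃ p ∈ borelSubgroup m F, p ∈ maxCompact F m ∧ ∃ v ∈ iwahori F m,
      (∀ i j, i < j → v i j = 0) ∧ (∀ i j, i < j → (v⁻¹ : GL (Fin m) F) i j = 0) ∧ b = p * v := by
  obtain ⟨u, hu, hub⟩ := exists_map_of_mem_iwahori (inv_mem hb)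
  -- `u` lifts `b⁻¹`: the available factorization has the lower factor on the left, and inverting it
  -- puts the upper factor first.
  obtain ⟨L, U, hL, hU, h⟩ := exists_lower_mul_upper (A := 1) (C := u)
    (fun i j hij => by rw [Units.val_one, one_apply_ne hij.ne]; exact zero_mem _) hu
  have hp := inv_mem (map_mem_borel hU)
  have hp' : (GeneralLinearGroup.map (integers F).subtype U)⁻¹ ∈ maxCompact F m :=
    inv_mem ⟨U, rfl⟩
  have hbv : b = (GeneralLinearGroup.map (integers F).subtype U)⁻¹ *
      (GeneralLinearGroup.map (integers F).subtype L)⁻¹ := by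
    rw [← _root_.mul_inv_rev, ← map_mul, ← h, one_mul, hub, inv_inv]
  have hL' : ∀ i j, i < j → (L⁻¹ : GL (Fin m) (integers F)) i j = 0 := by
    have h1 := upper_inv (a := revConj L) fun i j hij => hL _ _ (Fin.rev_lt_rev.2 hij)
    intro i j hij
    have h2 := h1 i.rev j.rev (Fin.rev_lt_rev.2 hij)
    rwa [← map_inv, revConj_apply, Fin.rev_rev, Fin.rev_rev] at h2
  refine ⟨_, hp, hp', (GeneralLinearGroup.map (integers F).subtype L)⁻¹, ?_, ?_, ?_, hbv⟩
  · have := mul_mem (inv_mem (mem_iwahori_of_mem_borel hp hp')) hb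
    rwa [hbv, inv_mul_cancel_left] at this
  · intro i j hij
    rw [← map_inv]
    exact congrArg Subtype.val (hL' i j hij)
  · intro i j hij
    rw [inv_inv]
    exact congrArg Subtype.val (hL i j hij)

lemma apply_eq_one_of_norm_le_one {ψ : AddChar F ℂ} (hψ : HasConductorIntegers ψ) {x : F}
    (hx : ‖x‖ ≤ 1) : ψ x = 1 :=
  (hψ 1).2 norm_one.le x (by rwa [norm_one])

/-- The block factorization is carried out over the ring of integers, so the trace of `g⁻¹ w₀ Y` is
integral and ψ is trivial on it. -/
lemma exists_borel_mul_conjShalika {ψ : AddChar F ℂ} (hψ : HasConductorIntegers ψ) {n : ℕ}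
    {b : GL (Fin (n + n)) F} (hb : b ∈ iwahori F (n + n)) :
    ∃ p ∈ borelSubgroup (n + n) F, p ∈ maxCompact F (n + n) ∧ ∃ h ∈ conjShalika n F,
      conjShalikaChar ψ h = 1 ∧ b = p * h := by
  obtain ⟨u, hu, rfl⟩ := exists_map_of_mem_iwahori hb
  obtain ⟨p, g, Y, hp, h⟩ := exists_upper_mul_blocks u hu
  let φ := GeneralLinearGroup.map (n := Fin (n + n)) (integers F).subtype
  let φ' := GeneralLinearGroup.map (n := Fin n) (integers F).subtype
  have hh : (φ (p⁻¹ * u)).val = blocks (φ' g).val 0 (Y.map (integers F).subtype)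
      (revConj (φ' g)).val := by
    have h1 : (p⁻¹ * u).val = blocks g.val 0 Y (revConj g).val := by
      rw [Units.val_mul, h, ← mul_assoc, Units.inv_mul, one_mul]
    ext i j
    change (((p⁻¹ * u).val i j : integers F) : F) = _
    rw [h1]
    refine Fin.addCases (fun i => ?_) (fun i => ?_) i <;>
      refine Fin.addCases (fun j => ?_) (fun j => ?_) j <;>
      simp only [blocks_apply₁₁, blocks_apply₁₂, blocks_apply₂₁, blocks_apply₂₂] <;> rfl
  refine ⟨φ p, map_mem_borel hp, ⟨p, rfl⟩, φ (p⁻¹ * u), (mem_conjShalika_iff _).2 ⟨_, _, hh⟩, ?_, ?_⟩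
  · rw [conjShalikaChar_eq ψ hh]
    refine apply_eq_one_of_norm_le_one hψ ((mem_integers _).1 ?_)
    rw [trace]
    refine sum_mem fun i _ => ?_
    rw [diag_apply, mul_apply]
    refine sum_mem fun j _ => mul_mem ?_ ?_
    · rw [← map_inv]
      exact ((g⁻¹ : GL (Fin n) (integers F)) i j).2
    · rw [mul_apply]
      refine sum_mem fun l _ => mul_mem ?_ (Y l i).2
      rw [antidiag, of_apply]
      split_ifs
      · exact one_mem _
      · exact zero_mem _
  · rw [← map_mul, mul_inv_cancel_left]

/-- Two factorizations of one element differ by an element of P ∩ H, invisible to Ψ_H, so the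
integral factorization decides the value. -/
lemma conjShalikaChar_eq_one_of_mul {ψ : AddChar F ℂ} (hψ : HasConductorIntegers ψ) {n : ℕ}
    {p h : GL (Fin (n + n)) F} (hp : p ∈ borelSubgroup (n + n) F) (hh : h ∈ conjShalika n F)
    (hb : p * h ∈ iwahori F (n + n)) : conjShalikaChar ψ h = 1 := by
  obtain ⟨p₀, hp₀, -, h₀, hh₀, h1, hbh⟩ := exists_borel_mul_conjShalika hψ hb
  have ht : p₀⁻¹ * p = h₀ * h⁻¹ := by
    rw [eq_mul_inv_iff_mul_eq, mul_assoc, hbh, inv_mul_cancel_left]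
  rw [← h1, ← conjShalikaChar_borel_mul ψ (mul_mem (inv_mem hp₀) hp)
    (ht ▸ mul_mem hh₀ (inv_mem hh)) hh, mul_assoc, hbh, inv_mul_cancel_left]

lemma norm_diag_eq_one {m : ℕ} {p : GL (Fin m) F} (hp : p ∈ borelSubgroup m F)
    (hp' : p ∈ maxCompact F m) (i : Fin m) : ‖p i i‖ = 1 := by
  have h := diag_mul_of_mem_borel hp (inv_mem hp) i
  rw [mul_inv_cancel, Units.val_one, one_apply_eq] at h
  have h1 := ((mem_maxCompact_iff p).1 hp' i i)
  have h2 := congrArg norm h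
  rw [norm_one, norm_mul] at h2
  nlinarith [norm_nonneg (p i i), norm_nonneg ((p⁻¹ : GL (Fin m) F) i i)]

lemma delta_eq_one {m : ℕ} {p : GL (Fin m) F} (hp : ∀ i, ‖p i i‖ = 1) : delta p = 1 :=
  Finset.prod_eq_one fun i _ => by rw [hp, _root_.one_zpow]

lemma chiDeltaHalf_eq_one {m : ℕ} (z : Fin m → ℂ) {p : GL (Fin m) F} (hp : ∀ i, ‖p i i‖ = 1) :
    chiDeltaHalf z p = 1 := by
  rw [chiDeltaHalf, delta_eq_one hp, unramChar, Finset.prod_eq_one fun i _ => by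
    rw [hp, Complex.ofReal_one, Complex.one_cpow]]
  simp

lemma rev_ne_self {n : ℕ} (i : Fin (n + n)) : i.rev ≠ i := fun h => by
  have := congrArg Fin.val h
  rw [Fin.val_rev] at this
  omega

/-- The character `χ δ^{1/2}` is trivial on the torus `P ∩ H`. -/
lemma chiDeltaHalf_eq_one_of_mem_conjShalika {n : ℕ} {z : Fin (n + n) → ℂ}
    (hz : ∀ i, z i.rev = -z i) {t : GL (Fin (n + n)) F} (ht : t ∈ borelSubgroup (n + n) F)
    (ht' : t ∈ conjShalika n F) : chiDeltaHalf z t = 1 := by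
  have hd : delta t = 1 := by
    -- The factors at `i` and `i.rev` have equal bases and opposite exponents; as the size is even,
    -- no index is its own partner.
    refine Finset.prod_involution (fun i _ => i.rev) (fun i _ => ?_) (fun i _ _ => rev_ne_self i)
      (fun _ _ => Finset.mem_univ _) (fun i _ => Fin.rev_rev i)
    rw [apply_rev_of_mem_borel_of_mem_conjShalika ht ht',
      ← zpow_add₀ (norm_ne_zero_iff.2 (diag_ne_zero ht i))]
    convert zpow_zero _
    rw [Fin.val_rev]
    have := i.2
    push_cast [Nat.cast_sub (show (i : ℕ) + 1 ≤ n + n by omega)]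
    ring
  have hu : unramChar z t = 1 := by
    refine Finset.prod_involution (fun i _ => i.rev) (fun i _ => ?_) (fun i _ _ => rev_ne_self i)
      (fun _ _ => Finset.mem_univ _) (fun i _ => Fin.rev_rev i)
    rw [apply_rev_of_mem_borel_of_mem_conjShalika ht ht', hz,
      ← Complex.cpow_add _ _ (Complex.ofReal_ne_zero.2 (norm_ne_zero_iff.2 (diag_ne_zero ht i))),
      add_neg_cancel, Complex.cpow_zero]
  rw [chiDeltaHalf, hd, hu]
  simp

lemma openOrbitKernel_eq_one {ψ : AddChar F ℂ} (hψ : HasConductorIntegers ψ) {n : ℕ}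
    {z : Fin (n + n) → ℂ} (hz : ∀ i, z i.rev = -z i) {b : GL (Fin (n + n)) F}
    (hb : b ∈ iwahori F (n + n)) : openOrbitKernel ψ z b = 1 := by
  obtain ⟨p₀, hp₀, hp₀', h₀, hh₀, h1, hbh⟩ := exists_borel_mul_conjShalika hψ hb
  have hx : b ∈ openOrbit n F := ⟨(⟨p₀, hp₀⟩, ⟨h₀, hh₀⟩), hbh⟩
  rw [openOrbitKernel, dif_pos hx]
  have hs := hx.choose_spec
  -- The kernel is defined through an arbitrary factorization, which is now compared with the
  -- integral one.
  generalize hx.choose = q at hs ⊢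
  obtain ⟨⟨p, hp⟩, ⟨h, hh⟩⟩ := q
  simp only at hs ⊢
  have ht : p₀⁻¹ * p = h₀ * h⁻¹ := by
    rw [eq_mul_inv_iff_mul_eq, mul_assoc, ← hs, hbh, inv_mul_cancel_left]
  have hp1 : chiDeltaHalf (-z) p = 1 := by
    have h2 := chiDeltaHalf_mul (-z) hp₀ (mul_mem (inv_mem hp₀) hp)
    rwa [mul_inv_cancel_left, chiDeltaHalf_eq_one _ (norm_diag_eq_one hp₀ hp₀'),
      chiDeltaHalf_eq_one_of_mem_conjShalika (by simp [hz]) (mul_mem (inv_mem hp₀) hp)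
        (ht ▸ mul_mem hh₀ (inv_mem hh)), one_mul] at h2
  rw [hp1, conjShalikaChar_eq_one_of_mul hψ hp hh (hs ▸ hb)]
  simp

end Iwahori

/-! ### Conjugation by antidominant elements -/

section Conj

variable {m : ℕ}

lemma mem_maxCompact_of_norm_le {x y : GL (Fin m) F} (hx : x ∈ maxCompact F m)
    (h : ∀ i j, ‖y i j‖ ≤ ‖x i j‖)
    (h' : ∀ i j, ‖(y⁻¹ : GL (Fin m) F) i j‖ ≤ ‖(x⁻¹ : GL (Fin m) F) i j‖) : y ∈ maxCompact F m :=
  (mem_maxCompact_iff y).2 fun i j => ⟨(h i j).trans ((mem_maxCompact_iff x).1 hx i j).1,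
    (h' i j).trans ((mem_maxCompact_iff x).1 hx i j).2⟩

/-- If the entries of `d` decrease in size, then conjugation by `d` contracts the lower triangular
matrices. -/
lemma norm_diagGL_inv_conj_le {d : Fin m → Fˣ} (hd : ∀ i j, i ≤ j → ‖(d i : F)‖ ≤ ‖(d j : F)‖)
    {x : GL (Fin m) F} (hx : ∀ i j, i < j → x i j = 0) (i j : Fin m) :
    ‖((diagGL d)⁻¹ * x * diagGL d) i j‖ ≤ ‖x i j‖ := by
  rw [diagGL_conj_apply', norm_mul, norm_mul, norm_inv]
  have h0 : 0 < ‖(d i : F)‖ := norm_pos_iff.2 (d i).ne_zero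
  rcases lt_or_ge i j with h | h
  · simp [hx i j h]
  · rw [mul_right_comm, inv_mul_eq_div]
    exact mul_le_of_le_one_left (norm_nonneg _) ((div_le_one h0).2 (hd j i h))

lemma norm_diagGL_conj_le {d : Fin m → Fˣ} (hd : ∀ i j, i ≤ j → ‖(d i : F)‖ ≤ ‖(d j : F)‖)
    {x : GL (Fin m) F} (hx : ∀ i j, j < i → x i j = 0) (i j : Fin m) :
    ‖(diagGL d * x * (diagGL d)⁻¹) i j‖ ≤ ‖x i j‖ := by
  rw [diagGL_conj_apply, norm_mul, norm_mul, norm_inv]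
  have h0 : 0 < ‖(d j : F)‖ := norm_pos_iff.2 (d j).ne_zero
  rcases lt_or_ge j i with h | h
  · simp [hx i j h]
  · rw [mul_right_comm, ← div_eq_mul_inv]
    exact mul_le_of_le_one_left (norm_nonneg _) ((div_le_one h0).2 (hd i j h))

lemma diagGL_conj_mem_maxCompact {d : Fin m → Fˣ}
    (hd : ∀ i j, i ≤ j → ‖(d i : F)‖ ≤ ‖(d j : F)‖) {p : GL (Fin m) F}
    (hp : p ∈ borelSubgroup m F) (hp' : p ∈ maxCompact F m) :
    diagGL d * p * (diagGL d)⁻¹ ∈ maxCompact F m := by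
  refine mem_maxCompact_of_norm_le hp' (norm_diagGL_conj_le hd hp) fun i j => ?_
  have : (diagGL d * p * (diagGL d)⁻¹)⁻¹ = diagGL d * p⁻¹ * (diagGL d)⁻¹ := by group
  rw [this]
  exact norm_diagGL_conj_le hd (inv_mem hp) i j

lemma diagGL_inv_conj_mem_iwahori {d : Fin m → Fˣ}
    (hd : ∀ i j, i ≤ j → ‖(d i : F)‖ ≤ ‖(d j : F)‖) {v : GL (Fin m) F} (hv : v ∈ iwahori F m)
    (h : ∀ i j, i < j → v i j = 0) (h' : ∀ i j, i < j → (v⁻¹ : GL (Fin m) F) i j = 0) :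
    (diagGL d)⁻¹ * v * diagGL d ∈ iwahori F m := by
  refine (mem_iwahori_iff _).2 ⟨mem_maxCompact_of_norm_le (iwahori_le_maxCompact hv)
    (norm_diagGL_inv_conj_le hd h) fun i j => ?_, fun i j hij =>
      (norm_diagGL_inv_conj_le hd h i j).trans_lt (((mem_iwahori_iff v).1 hv).2 i j hij)⟩
  have : ((diagGL d)⁻¹ * v * diagGL d)⁻¹ = (diagGL d)⁻¹ * v⁻¹ * diagGL d := by group
  rw [this]
  exact norm_diagGL_inv_conj_le hd h' i j

lemma gLam_antidominant {n : ℕ} {ϖ : Fˣ} (hϖ : ‖(ϖ : F)‖ ≤ 1) {l : Fin n → ℤ} (hl : Antitone l)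
    (hl' : ∀ i, 0 ≤ l i) (i j : Fin (n + n)) (hij : i ≤ j) :
    ‖(Fin.append (fun i => ϖ ^ l i) (fun _ => 1) i : Fˣ).val‖ ≤
      ‖(Fin.append (fun i => ϖ ^ l i) (fun _ => 1) j : Fˣ).val‖ := by
  have h0 : 0 < ‖(ϖ : F)‖ := norm_pos_iff.2 ϖ.ne_zero
  revert hij
  refine Fin.addCases (fun i => ?_) (fun i => ?_) i <;>
    refine Fin.addCases (fun j => ?_) (fun j => ?_) j <;> intro hij
  · rw [Fin.append_left, Fin.append_left, Units.val_zpow_eq_zpow_val, Units.val_zpow_eq_zpow_val,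
      norm_zpow, norm_zpow]
    exact zpow_le_zpow_right_of_le_one₀ h0 hϖ (hl hij)
  · rw [Fin.append_left, Fin.append_right, Units.val_zpow_eq_zpow_val, norm_zpow, Units.val_one,
      norm_one]
    exact zpow_le_one₀ h0 hϖ (hl' i)
  · exact absurd hij (by simp only [Fin.le_def, Fin.val_natAdd, Fin.val_castAdd]; omega)
  · rw [Fin.append_right, Fin.append_right]

end Conj

/-! ### Cosets of open compact subgroups -/

section Cosets

variable {G : Type*} [Group G]

lemma indicator_eq_sum_cosets {A C : Subgroup G} (hCA : C ≤ A) [Fintype (A ⧸ C.subgroupOf A)]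
    (x : G) : (A : Set G).indicator (1 : G → ℂ) x =
      ∑ q : A ⧸ C.subgroupOf A, (C : Set G).indicator (1 : G → ℂ) ((q.out : G)⁻¹ * x) := by
  by_cases hx : x ∈ A
  · have h : ∀ q : A ⧸ C.subgroupOf A, (q.out : G)⁻¹ * x ∈ C ↔ q = QuotientGroup.mk ⟨x, hx⟩ := by
      intro q
      conv_rhs => rw [← QuotientGroup.out_eq' q]
      rw [QuotientGroup.eq, Subgroup.mem_subgroupOf]
      rfl
    rw [Finset.sum_eq_single (QuotientGroup.mk ⟨x, hx⟩), Set.indicator_of_mem hx,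
      Set.indicator_of_mem ((h _).2 rfl)]
    · rfl
    · exact fun q _ hq => Set.indicator_of_notMem (fun h' => hq ((h q).1 h')) _
    · simp
  · rw [Set.indicator_of_notMem hx, Finset.sum_eq_zero]
    exact fun q _ => Set.indicator_of_notMem
      (fun h => hx ((Subgroup.mul_mem_cancel_left _ (inv_mem q.out.2)).1 (hCA h))) _

lemma indicator_inv (C : Subgroup G) (x : G) :
    (C : Set G).indicator (1 : G → ℂ) x⁻¹ = (C : Set G).indicator 1 x := by
  by_cases hx : x ∈ C
  · rw [Set.indicator_of_mem hx, Set.indicator_of_mem (inv_mem hx)]; rfl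
  · rw [Set.indicator_of_notMem hx, Set.indicator_of_notMem (fun h => hx (inv_mem_iff.1 h))]

/-- Inversion preserves both subgroups and turns the left cosets into right ones. -/
lemma indicator_eq_sum_right_cosets {A C : Subgroup G} (hCA : C ≤ A)
    [Fintype (A ⧸ C.subgroupOf A)] (x : G) : (A : Set G).indicator (1 : G → ℂ) x =
      ∑ q : A ⧸ C.subgroupOf A, (C : Set G).indicator (1 : G → ℂ) (x * q.out) := by
  rw [← indicator_inv, indicator_eq_sum_cosets hCA]
  exact Finset.sum_congr rfl fun q _ => by rw [← _root_.mul_inv_rev, indicator_inv]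

variable [TopologicalSpace G] [IsTopologicalGroup G]

lemma finite_quotient_subgroupOf {A C : Subgroup G} (hA : IsCompact (A : Set G))
    (hC : IsOpen (C : Set G)) : Finite (A ⧸ C.subgroupOf A) := by
  have : CompactSpace A := isCompact_iff_compactSpace.1 hA
  exact Subgroup.quotient_finite_of_isOpen _ (hC.preimage continuous_subtype_val)

variable [MeasurableSpace G] [BorelSpace G] (μ : Measure G) [μ.IsHaarMeasure]

lemma measureReal_eq_card_mul {A C : Subgroup G} (hCA : C ≤ A) (hA : IsCompact (A : Set G))
    (hC : IsOpen (C : Set G)) :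
    μ.real A = Nat.card (A ⧸ C.subgroupOf A) * μ.real C := by
  have := finite_quotient_subgroupOf hA hC
  have := Fintype.ofFinite (A ⧸ C.subgroupOf A)
  have hm : MeasurableSet (C : Set G) := hC.measurableSet
  have hC' : IsCompact (C : Set G) :=
    hA.of_isClosed_subset (Subgroup.isClosed_of_isOpen _ hC) hCA
  have hmA : MeasurableSet (A : Set G) := (Subgroup.isOpen_mono hCA hC).measurableSet
  have hint : Integrable ((C : Set G).indicator (1 : G → ℂ)) μ :=
    (integrable_indicator_iff hm).2 (integrableOn_const hC'.measure_lt_top.ne)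
  have h1 : ∫ x, (A : Set G).indicator (1 : G → ℂ) x ∂μ =
      ∑ q : A ⧸ C.subgroupOf A, ∫ x, (C : Set G).indicator (1 : G → ℂ) ((q.out : G)⁻¹ * x) ∂μ := by
    rw [← integral_finsetSum _ fun q _ => hint.comp_mul_left _]
    exact integral_congr_ae (.of_forall fun x => indicator_eq_sum_cosets hCA x)
  simp_rw [integral_mul_left_eq_self] at h1
  have h2 : ∀ S : Set G, MeasurableSet S → ∫ x, S.indicator (1 : G → ℂ) x ∂μ = μ.real S :=
    fun S hS => by
      rw [integral_indicator hS]
      simp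
  rw [h2 _ hmA, h2 _ hm, Finset.sum_const, Finset.card_univ, ← Nat.card_eq_fintype_card,
    nsmul_eq_mul] at h1
  exact_mod_cast h1

end Cosets

/-! ### The modular character -/

section Modular

variable {G : Type*} [Group G] [TopologicalSpace G] [IsTopologicalGroup G] [LocallyCompactSpace G]
  [SecondCountableTopology G]

/-- This fixes the convention for the modular character: it is the factor by which right translation
scales a left Haar measure under push-forward. -/
lemma map_mul_right_eq_modularCharacter_smul [MeasurableSpace G] [BorelSpace G] (μ : Measure G)
    [μ.IsHaarMeasure] (g : G) :
    μ.map (· * g) = Measure.modularCharacter g • μ := by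
  change _ = Measure.modularCharacterFun g • μ
  rw [Measure.modularCharacterFun_eq_haarScalarFactor μ]
  exact Measure.isMulLeftInvariant_eq_smul _ _

lemma measureReal_preimage_mul_right [MeasurableSpace G] [BorelSpace G] (μ : Measure G)
    [μ.IsHaarMeasure] (g : G) {A : Set G} (hA : MeasurableSet A) :
    μ.real ((· * g) ⁻¹' A) = Measure.modularCharacter g * μ.real A := by
  have h := congrArg (fun ν : Measure G => ν.real A) (map_mul_right_eq_modularCharacter_smul μ g)
  simp only [Measure.real] at h ⊢
  rw [Measure.map_apply (measurable_mul_const g) hA] at h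
  rw [h, Measure.smul_apply, ENNReal.smul_def, smul_eq_mul, ENNReal.toReal_mul,
    ENNReal.coe_toReal]

lemma measureReal_pos [MeasurableSpace G] [BorelSpace G] (μ : Measure G)
    [μ.IsHaarMeasure] {A : Subgroup G} (hA : IsCompact (A : Set G)) (hA' : IsOpen (A : Set G)) :
    0 < μ.real A :=
  ENNReal.toReal_pos (hA'.measure_pos μ ⟨1, one_mem _⟩).ne' hA.measure_lt_top.ne

lemma modularCharacter_eq_one_of_mem {A : Subgroup G} (hA : IsCompact (A : Set G))
    (hA' : IsOpen (A : Set G)) {g : G} (hg : g ∈ A) : Measure.modularCharacter g = 1 := by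
  borelize G
  have h := measureReal_preimage_mul_right Measure.haar g hA'.measurableSet
  have h1 : (· * g) ⁻¹' (A : Set G) = A := by
    ext x; exact Subgroup.mul_mem_cancel_right _ hg
  rw [h1] at h
  exact NNReal.coe_injective
    (mul_right_cancel₀ (measureReal_pos Measure.haar hA hA').ne' (by rw [← h, NNReal.coe_one, one_mul]))

/-- The preimage is `g A g⁻¹`; the left factor does not affect the volume. -/
lemma measureReal_conj [MeasurableSpace G] [BorelSpace G] (μ : Measure G)
    [μ.IsHaarMeasure] (g : G) {A : Set G} (hA : MeasurableSet A) :
    μ.real ((fun x => g⁻¹ * x * g) ⁻¹' A) = Measure.modularCharacter g * μ.real A := by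
  rw [← measureReal_preimage_mul_right μ g hA]
  simp only [Measure.real]
  rw [← measure_preimage_mul μ g⁻¹ ((· * g) ⁻¹' A)]
  rfl

/-- Right translation by `g` is left translation and so preserves Haar measure. A bump function of
positive integral shows that the scaling factor is 1. -/
lemma modularCharacter_eq_one_of_central {g : G} (hg : ∀ x, g * x = x * g) :
    Measure.modularCharacter g = 1 := by
  borelize G
  obtain ⟨⟨f, hf⟩, hc, h0, h1⟩ := exists_continuous_nonneg_pos (1 : G)
  have hpos := (hf.integral_pos_of_hasCompactSupport_nonneg_nonzero (μ := Measure.haar) hc h0 h1)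
  have h := congrArg (fun ν => ∫ x, f x ∂ν)
    (map_mul_right_eq_modularCharacter_smul Measure.haar g)
  have h2 : (Measure.haar : Measure G).map (· * g) = Measure.haar := by
    simp_rw [← hg]
    exact map_mul_left_eq_self _ g
  simp only [h2, integral_smul_nnreal_measure] at h
  refine NNReal.coe_injective (mul_right_cancel₀ hpos.ne' ?_)
  rw [NNReal.coe_one, one_mul]
  exact h.symm

end Modular

/-! ### Triviality of the modular character of GL_m on diagonal matrices -/

section LocalField

variable {F : Type*} [NontriviallyNormedField F] [IsUltrametricDist F] [LocallyCompactSpace F]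
  {m : ℕ}

instance : SecondCountableTopology (GL (Fin m) F) := by
  have : ProperSpace F := .of_locallyCompactSpace F
  have : SecondCountableTopology (Matrix (Fin m) (Fin m) F) :=
    inferInstanceAs (SecondCountableTopology (Fin m → Fin m → F))
  have : SecondCountableTopology (Matrix (Fin m) (Fin m) F)ᵐᵒᵖ :=
    MulOpposite.opHomeomorph.symm.secondCountableTopology
  exact Units.isEmbedding_embedProduct.secondCountableTopology

/-- Placing `x` at different diagonal positions gives matrices conjugate by permutations, hence
equal values. The product of these values over all positions is the value at a scalar matrix, which
is central, so each value is a nonnegative m-th root of 1. -/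
lemma modularCharacter_diagGL (d : Fin m → Fˣ) :
    Measure.modularCharacter (diagGL d : GL (Fin m) F) = 1 := by
  suffices h : (Measure.modularCharacter (G := GL (Fin m) F)).comp diagGL = 1 from
    DFunLike.congr_fun h d
  refine MonoidHom.pi_ext fun i x => ?_
  let φ : Fin m → ℝ≥0 := fun i => Measure.modularCharacter (diagGL (Pi.mulSingle i x) : GL (Fin m) F)
  have hφ : ∀ j, φ j = φ i := by
    intro j
    have h := permGL_conj_diagGL (Equiv.swap i j) (Pi.mulSingle i x : Fin m → Fˣ)
    have h1 : (fun l => (Pi.mulSingle i x : Fin m → Fˣ) ((Equiv.swap i j)⁻¹ l)) =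
        Pi.mulSingle j x := by
      ext l
      rw [Equiv.swap_inv, Pi.mulSingle_apply, Pi.mulSingle_apply]
      congr 2
      rw [Equiv.swap_apply_eq_iff, Equiv.swap_apply_left]
    rw [h1] at h
    simp only [φ]
    rw [← h, map_mul, map_mul, mul_right_comm, ← map_mul, mul_inv_cancel, map_one, one_mul]
  have hprod : ∏ j, φ j = 1 := by
    have h := map_prod (Measure.modularCharacter.comp (diagGL (m := m) (k := F)))
      (fun j => Pi.mulSingle j x) Finset.univ
    rw [Finset.univ_prod_mulSingle (fun _ => x)] at h
    refine h.symm.trans (modularCharacter_eq_one_of_central (g := diagGL fun _ => x) fun y => ?_)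
    ext i j
    rw [GeneralLinearGroup.coe_mul, GeneralLinearGroup.coe_mul, diagGL_val, mul_diagonal,
      diagonal_mul, mul_comm]
  simp only [hφ, Finset.prod_const] at hprod
  exact (pow_eq_one_iff_of_nonneg (zero_le) (by
    rw [Finset.card_univ, Fintype.card_fin]; exact (i.pos).ne')).1 hprod

end LocalField

/-! ### The modular character of the Borel subgroup -/

section BorelModular

variable {F : Type*} [NontriviallyNormedField F] [IsUltrametricDist F] {m : ℕ}

lemma map_subtype_injective :
    Function.Injective (GeneralLinearGroup.map (n := Fin m) (integers F).subtype) := by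
  intro a b h
  ext i j
  exact congrArg (fun g : GL (Fin m) F => g i j) h

/-- The integral points of the Borel subgroup. -/
def integralBorel (F : Type*) [NontriviallyNormedField F] [IsUltrametricDist F] (m : ℕ) :
    Subgroup (borelSubgroup m F) :=
  (maxCompact F m).subgroupOf (borelSubgroup m F)

/-- Reduction of the integral points of the Borel subgroup modulo the maximal ideal. -/
def borelReduction (F : Type*) [NontriviallyNormedField F] [IsUltrametricDist F] (m : ℕ) :
    integralBorel F m →* GL (Fin m) (residueField F) :=
  (GeneralLinearGroup.map (IsLocalRing.residue (integers F))).comp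
    ((MonoidHom.ofInjective (map_subtype_injective (F := F) (m := m))).symm.toMonoidHom.comp
      ((borelSubgroup m F).subtype.subgroupComap (maxCompact F m)))

lemma borelReduction_eq {x : integralBorel F m} {u : GL (Fin m) (integers F)}
    (h : GeneralLinearGroup.map (integers F).subtype u = x) :
    borelReduction F m x = GeneralLinearGroup.map (IsLocalRing.residue (integers F)) u := by
  change GeneralLinearGroup.map (IsLocalRing.residue (integers F)) _ = _
  congr 1
  exact (MulEquiv.symm_apply_eq (MonoidHom.ofInjective map_subtype_injective)).2
    (Subtype.ext h.symm)

lemma borelReduction_apply_eq_zero_iff (x : integralBorel F m) (i j : Fin m) :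
    borelReduction F m x i j = 0 ↔ ‖(x : GL (Fin m) F) i j‖ < 1 := by
  obtain ⟨u, hu⟩ := x.2
  rw [borelReduction_eq hu, map_residue_apply, residue_eq_zero_iff]
  have : (x : GL (Fin m) F) i j = (u i j : F) := congrArg (fun g : GL (Fin m) F => g i j) hu.symm
  rw [this]

lemma borelReduction_upper (x : integralBorel F m) {i j : Fin m} (hij : j < i) :
    borelReduction F m x i j = 0 := by
  rw [borelReduction_apply_eq_zero_iff, x.1.2 i j hij, norm_zero]
  exact one_pos

/-- The integral points of the Borel subgroup act on the matrices over the residue field by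
conjugation. -/
abbrev conjAction (F : Type*) [NontriviallyNormedField F] [IsUltrametricDist F] (m : ℕ) :
    MulAction (integralBorel F m) (Matrix (Fin m) (Fin m) (residueField F)) where
  smul x M := (borelReduction F m x).val * M * (borelReduction F m x⁻¹).val
  one_smul M := by
    change (borelReduction F m 1).val * M * (borelReduction F m 1⁻¹).val = M
    simp
  mul_smul x y M := by
    change (borelReduction F m (x * y)).val * M * (borelReduction F m (x * y)⁻¹).val =
      (borelReduction F m x).val * ((borelReduction F m y).val * M * (borelReduction F m y⁻¹).val) *
        (borelReduction F m x⁻¹).val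
    simp only [_root_.mul_inv_rev, map_mul, Units.val_mul, mul_assoc]

/-- The diagonal projection onto the first `k` coordinates. -/
def diagProj (m : ℕ) (R : Type*) [Zero R] [One R] (k : ℕ) : Matrix (Fin m) (Fin m) R :=
  diagonal fun i => if (i : ℕ) < k then 1 else 0

/-- The stabilizer is a commutation condition: an upper triangular matrix commutes with the
projection exactly when its upper right block vanishes. This realizes a congruence subgroup as a
stabilizer, so that its index is the size of an orbit. -/
lemma mem_stabilizer_diagProj_iff (k : ℕ) (x : integralBorel F m) :
    x ∈ @MulAction.stabilizer _ _ _ (conjAction F m) (diagProj m (residueField F) k) ↔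
      ∀ i j : Fin m, (i : ℕ) < k → k ≤ j → ‖(x : GL (Fin m) F) i j‖ < 1 := by
  let _ := conjAction F m
  rw [MulAction.mem_stabilizer_iff]
  change (borelReduction F m x).val * _ * (borelReduction F m x⁻¹).val = _ ↔ _
  have h : (borelReduction F m x).val * diagProj m (residueField F) k *
      (borelReduction F m x⁻¹).val = diagProj m (residueField F) k ↔
      (borelReduction F m x).val * diagProj m (residueField F) k =
      diagProj m (residueField F) k * (borelReduction F m x).val := by
    rw [map_inv]
    exact Units.mul_inv_eq_iff_eq_mul _
  rw [h, ← Matrix.ext_iff]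
  simp only [← borelReduction_apply_eq_zero_iff, diagProj, mul_diagonal, diagonal_mul]
  refine forall_congr' fun i => forall_congr' fun j => ?_
  by_cases hi : (i : ℕ) < k <;> by_cases hj : (j : ℕ) < k
  · simp [hi, hj]
  · simp [hi, hj, not_lt.1 hj, eq_comm]
  · simp [hi, hj, borelReduction_upper x (show j < i by rw [Fin.lt_def]; omega)]
  · simp [hi, hj]

/-- Conjugation by upper triangular matrices can alter only the upper right block of the projection
E. Every block N is reached, since NE = 0 and EN = N give (1 - N)E(1 + N) = E + N. -/
lemma orbit_diagProj (k : ℕ) :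
    @MulAction.orbit (integralBorel F m) _ (conjAction F m).toSMul (diagProj m (residueField F) k) =
      {M | ∀ i j : Fin m, ¬((i : ℕ) < k ∧ k ≤ j) → M i j = diagProj m (residueField F) k i j} := by
  let _ := conjAction F m
  ext M
  rw [MulAction.mem_orbit_iff, Set.mem_ofPred_eq]
  constructor
  · rintro ⟨x, rfl⟩ i j hij
    change ((borelReduction F m x).val * diagProj m (residueField F) k *
      (borelReduction F m x⁻¹).val) i j = _
    rw [mul_apply]
    simp only [diagProj, mul_diagonal]
    by_cases hi : (i : ℕ) < k
    · have hj : (j : ℕ) < k := by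
        by_contra h
        exact hij ⟨hi, not_lt.1 h⟩
      have h1 := congrArg (fun A : Matrix (Fin m) (Fin m) (residueField F) => A i j)
        (borelReduction F m x).mul_inv
      simp only [mul_apply] at h1
      have h2 : (1 : Matrix (Fin m) (Fin m) (residueField F)) i j =
          diagonal (fun i : Fin m => if (i : ℕ) < k then 1 else 0) i j := by
        by_cases h : i = j
        · subst h; simp [hi]
        · rw [one_apply_ne h, diagonal_apply_ne _ h]
      rw [← h2, ← h1, map_inv]
      refine Finset.sum_congr rfl fun l _ => ?_
      by_cases hl : (l : ℕ) < k
      · rw [if_pos hl, mul_one]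
      · have := borelReduction_upper x⁻¹ (show j < l by rw [Fin.lt_def]; omega)
        rw [map_inv] at this
        rw [this, mul_zero, mul_zero]
    · have h2 : diagonal (fun i : Fin m => if (i : ℕ) < k then (1 : residueField F) else 0) i j = 0 := by
        by_cases h : i = j
        · subst h; simp [hi]
        · rw [diagonal_apply_ne _ h]
      rw [h2]
      refine Finset.sum_eq_zero fun l _ => ?_
      by_cases hl : (l : ℕ) < k
      · rw [borelReduction_upper x (show l < i by rw [Fin.lt_def]; omega), zero_mul, zero_mul]
      · rw [if_neg hl, mul_zero, zero_mul]
  · intro hM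
    obtain ⟨σ, hσ⟩ := (IsLocalRing.residue_surjective (R := integers F)).hasRightInverse
    let N : Matrix (Fin m) (Fin m) (integers F) :=
      of fun i j => if (i : ℕ) < k ∧ k ≤ j then σ (M i j) else 0
    have hN : ∀ i j : Fin m, ¬((i : ℕ) < k ∧ k ≤ j) → N i j = 0 := fun i j h => if_neg h
    have hNN : N * N = 0 := by
      ext i j
      rw [mul_apply]
      refine congrArg Subtype.val (Finset.sum_eq_zero fun l _ => ?_)
      by_cases hl : (l : ℕ) < k
      · rw [hN i l (by omega), zero_mul]
      · rw [hN l j (by omega), mul_zero]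
    -- Invertible because N² = 0.
    let u : GL (Fin m) (integers F) :=
      ⟨1 - N, 1 + N, by simp [sub_mul, mul_add, hNN], by simp [add_mul, mul_sub, hNN]⟩
    have hu : ∀ i j, j < i → u i j = 0 := fun i j hij => by
      change (1 : Matrix (Fin m) (Fin m) (integers F)) i j - N i j = 0
      rw [one_apply_ne hij.ne', hN i j (by rw [Fin.lt_def] at hij; omega), sub_zero]
    let x : integralBorel F m := ⟨⟨_, map_mem_borel hu⟩, ⟨u, rfl⟩⟩
    refine ⟨x, ?_⟩
    change (borelReduction F m x).val * diagProj m (residueField F) k *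
      (borelReduction F m x⁻¹).val = M
    let N' : Matrix (Fin m) (Fin m) (residueField F) := (IsLocalRing.residue (integers F)).mapMatrix N
    have h1 : (borelReduction F m x).val = 1 - N' := by
      rw [borelReduction_eq (x := x) (u := u) rfl]
      exact (map_sub (IsLocalRing.residue (integers F)).mapMatrix _ _).trans (by rw [map_one])
    have h2 : (borelReduction F m x⁻¹).val = 1 + N' := by
      rw [map_inv, borelReduction_eq (x := x) (u := u) rfl, ← map_inv]
      exact (map_add (IsLocalRing.residue (integers F)).mapMatrix _ _).trans (by rw [map_one])
    have hN' : ∀ i j : Fin m, ¬((i : ℕ) < k ∧ k ≤ j) → N' i j = 0 := fun i j h => by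
      change IsLocalRing.residue (integers F) (N i j) = 0
      rw [hN i j h, map_zero]
    have hEN : diagProj m (residueField F) k * N' = N' := by
      ext i j
      rw [diagProj, diagonal_mul]
      by_cases hi : (i : ℕ) < k
      · rw [if_pos hi, one_mul]
      · rw [hN' i j (by omega), mul_zero]
    have hNE : N' * diagProj m (residueField F) k = 0 := by
      ext i j
      rw [diagProj, mul_diagonal]
      by_cases hj : (j : ℕ) < k
      · rw [hN' i j (by omega), zero_mul]; rfl
      · rw [if_neg hj, mul_zero]; rfl
    have hME : M = diagProj m (residueField F) k + N' := by
      ext i j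
      rw [Matrix.add_apply]
      by_cases h : (i : ℕ) < k ∧ k ≤ j
      · have h3 : N' i j = M i j := by
          change IsLocalRing.residue (integers F) (if (i : ℕ) < k ∧ k ≤ j then σ (M i j) else 0) = _
          rw [if_pos h, hσ]
        rw [h3, diagProj, diagonal_apply_ne _ (by rintro rfl; omega), zero_add]
      · rw [hM i j h, hN' i j h, add_zero]
    rw [h1, h2, sub_mul, one_mul, hNE, sub_zero, mul_add, mul_one, hEN, hME]

lemma ncard_block {κ : Type*} {k : ℕ} (hk : k ≤ m) (E : Matrix (Fin m) (Fin m) κ) :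
    {M : Matrix (Fin m) (Fin m) κ | ∀ i j : Fin m, ¬((i : ℕ) < k ∧ k ≤ j) → M i j = E i j}.ncard =
      Nat.card κ ^ (k * (m - k)) := by
  let e : {M : Matrix (Fin m) (Fin m) κ |
      ∀ i j : Fin m, ¬((i : ℕ) < k ∧ k ≤ j) → M i j = E i j} ≃
      ({i : Fin m // (i : ℕ) < k} × {j : Fin m // ¬ (j : ℕ) < k} → κ) :=
    { toFun := fun M s => M.1 s.1 s.2
      invFun := fun f => ⟨of fun i j => if h : (i : ℕ) < k ∧ k ≤ j then
          f (⟨i, h.1⟩, ⟨j, not_lt.2 h.2⟩) else E i j, fun i j h => dif_neg h⟩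
      left_inv := fun M => by
        ext i j
        by_cases h : (i : ℕ) < k ∧ k ≤ j
        · exact dif_pos h
        · exact (dif_neg h).trans (M.2 i j h).symm
      right_inv := fun f => by
        ext ⟨⟨i, hi⟩, ⟨j, hj⟩⟩
        exact dif_pos ⟨hi, not_lt.1 hj⟩ }
  have h1 : Fintype.card {i : Fin m // (i : ℕ) < k} = k := by
    rw [Fintype.card_subtype]
    simp [Fin.card_filter_val_lt, hk]
  rw [← Nat.card_coe_set_eq, Nat.card_congr e, Nat.card_fun, Nat.card_prod,
    Nat.card_eq_fintype_card (α := {i : Fin m // (i : ℕ) < k}),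
    Nat.card_eq_fintype_card (α := {i : Fin m // ¬ (i : ℕ) < k}), Fintype.card_subtype_compl, h1,
    Fintype.card_fin]

/-- The diagonal matrices as elements of the Borel subgroup. -/
def diagBorel : (Fin m → Fˣ) →* borelSubgroup m F :=
  diagGL.codRestrict _ diagGL_mem_borel

/-- The element `diag(ϖ, …, ϖ, 1, …, 1)`, with `k` entries `ϖ`. -/
def stepDiag (m : ℕ) (ϖ : Fˣ) (k : ℕ) : Fin m → Fˣ := fun i => if (i : ℕ) < k then ϖ else 1

lemma stepDiag_antidominant {ϖ : Fˣ} (hϖ : ‖(ϖ : F)‖ ≤ 1) (k : ℕ) (i j : Fin m) (hij : i ≤ j) :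
    ‖(stepDiag m ϖ k i : F)‖ ≤ ‖(stepDiag m ϖ k j : F)‖ := by
  rw [Fin.le_def] at hij
  unfold stepDiag
  split_ifs
  · exact le_rfl
  · simpa using hϖ
  · omega
  · exact le_rfl

/-- The conjugation divides the upper right block by ϖ, so the result is integral exactly when that
block lies in the maximal ideal. -/
lemma stepDiag_conj_mem_iff {ϖ : Fˣ} (hϖ : IsUniformizer (ϖ : F)) (k : ℕ) (x : integralBorel F m) :
    (diagBorel (stepDiag m ϖ k))⁻¹ * (x : borelSubgroup m F) * diagBorel (stepDiag m ϖ k) ∈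
      integralBorel F m ↔
    x ∈ @MulAction.stabilizer _ _ _ (conjAction F m) (diagProj m (residueField F) k) := by
  have h0 : 0 < ‖(ϖ : F)‖ := norm_pos_iff.2 ϖ.ne_zero
  change (diagGL (stepDiag m ϖ k))⁻¹ * (x : GL (Fin m) F) * diagGL (stepDiag m ϖ k) ∈
    maxCompact F m ↔ _
  constructor
  · intro h
    rw [mem_stabilizer_diagProj_iff]
    intro i j hi hj
    have h1 := ((mem_maxCompact_iff _).1 h i j).1
    rw [diagGL_conj_apply', stepDiag, if_pos hi, stepDiag, if_neg (not_lt.2 hj), Units.val_one,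
      mul_one, norm_mul, norm_inv, inv_mul_le_iff₀ h0, mul_one] at h1
    exact (hϖ _).2 h1
  · have key : ∀ y : integralBorel F m,
        y ∈ @MulAction.stabilizer _ _ _ (conjAction F m) (diagProj m (residueField F) k) →
        ∀ i j, ‖((diagGL (stepDiag m ϖ k))⁻¹ * (y : GL (Fin m) F) * diagGL (stepDiag m ϖ k)) i j‖ ≤
          1 := by
      intro y hy i j
      rw [mem_stabilizer_diagProj_iff] at hy
      have hyK := ((mem_maxCompact_iff _).1 y.2 i j).1
      rw [diagGL_conj_apply', norm_mul, norm_mul, norm_inv]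
      by_cases hi : (i : ℕ) < k <;> by_cases hj : (j : ℕ) < k
      · simpa [stepDiag, hi, hj, mul_right_comm, h0.ne'] using hyK
      · simpa [stepDiag, hi, hj, inv_mul_le_iff₀ h0] using (hϖ _).1 (hy i j hi (not_lt.1 hj))
      · rw [y.1.2 i j (by rw [Fin.lt_def]; omega)]
        simp
      · simpa [stepDiag, hi, hj] using hyK
    intro h
    refine (mem_maxCompact_iff _).2 fun i j => ⟨key x h i j, ?_⟩
    have h1 := key x⁻¹ (inv_mem h) i j
    have h2 : ((diagGL (stepDiag m ϖ k))⁻¹ * (x : GL (Fin m) F) * diagGL (stepDiag m ϖ k))⁻¹ =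
      (diagGL (stepDiag m ϖ k))⁻¹ * (x⁻¹ : GL (Fin m) F) * diagGL (stepDiag m ϖ k) := by group
    rwa [h2]

end BorelModular

/-! ### Comparison of δ with the modular character on generators of the Borel subgroup -/

section BorelModular

variable {F : Type*} [NontriviallyNormedField F] [IsUltrametricDist F] {m : ℕ}

lemma delta_mul {p q : GL (Fin m) F} (hp : p ∈ borelSubgroup m F) (hq : q ∈ borelSubgroup m F) :
    delta (p * q) = delta p * delta q := by
  unfold delta
  rw [← Finset.prod_mul_distrib]
  refine Finset.prod_congr rfl fun i _ => ?_
  rw [diag_mul_of_mem_borel hp hq, norm_mul, mul_zpow]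

/-- The modular character `δ` as a homomorphism. -/
def deltaHom : borelSubgroup m F →* ℝ where
  toFun p := delta (p : GL (Fin m) F)
  map_one' := delta_eq_one fun i => by simp
  map_mul' p q := delta_mul p.2 q.2

/-- The exponents m - 1 - 2i over i < k add up to k(m - k), the number of entries in the upper right
block. -/
lemma delta_stepDiag (ϖ : Fˣ) {k : ℕ} (hk : k ≤ m) :
    deltaHom (diagBorel (stepDiag m ϖ k)) = ‖(ϖ : F)‖ ^ (k * (m - k)) := by
  have h0 : ‖(ϖ : F)‖ ≠ 0 := norm_ne_zero_iff.2 ϖ.ne_zero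
  have h1 : deltaHom (diagBorel (stepDiag m ϖ k)) =
      ∏ i : Fin m, (fun i : ℕ => if i < k then ‖(ϖ : F)‖ ^ ((m : ℤ) - 1 - 2 * (i : ℤ)) else 1) i := by
    change delta (diagGL (stepDiag m ϖ k)) = _
    unfold delta
    refine Finset.prod_congr rfl fun i _ => ?_
    rw [diagGL_apply_self, stepDiag]
    split_ifs with h
    · exact (if_pos h).symm
    · rw [Units.val_one, norm_one, _root_.one_zpow]
      exact (if_neg h).symm
  rw [h1, Fin.prod_univ_eq_prod_range
    (fun i : ℕ => if i < k then ‖(ϖ : F)‖ ^ ((m : ℤ) - 1 - 2 * (i : ℤ)) else 1), Finset.prod_ite,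
    Finset.prod_const_one, mul_one]
  have h2 : (Finset.range m).filter (· < k) = Finset.range k := by
    ext i; simp only [Finset.mem_filter, Finset.mem_range]; omega
  have h3 : ∀ k : ℕ, ∏ i ∈ Finset.range k, ‖(ϖ : F)‖ ^ ((m : ℤ) - 1 - 2 * (i : ℤ)) =
      ‖(ϖ : F)‖ ^ ((k : ℤ) * (m - k)) := by
    intro k
    induction k with
    | zero => simp
    | succ k ih =>
      rw [Finset.prod_range_succ, ih, ← zpow_add₀ h0]
      congr 1
      push_cast
      ring
  rw [h2, h3, ← Nat.cast_sub hk, ← Nat.cast_mul, zpow_natCast]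

lemma exists_norm_eq_zpow {ϖ : Fˣ} (hϖ : IsUniformizer (ϖ : F)) (x : Fˣ) :
    ∃ (e : ℤ) (u : Fˣ), ‖(u : F)‖ = 1 ∧ x = ϖ ^ e * u := by
  have h0 : 0 < ‖(ϖ : F)‖ := norm_pos_iff.2 ϖ.ne_zero
  have h1 : ‖(ϖ : F)‖ < 1 := (hϖ _).2 le_rfl
  -- With this `e` the norm of ϖ^(e+1) x lies in (‖ϖ‖, 1], and a uniformizer leaves only the value 1
  -- there.
  obtain ⟨e, he, he'⟩ := exists_mem_Ioc_zpow (norm_pos_iff.2 x.ne_zero) ((one_lt_inv₀ h0).2 h1)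
  refine ⟨-(e + 1), ϖ ^ (e + 1) * x, ?_, ?_⟩
  · have hx := norm_pos_iff.2 x.ne_zero
    rw [_root_.inv_zpow, inv_lt_iff_one_lt_mul₀' (zpow_pos h0 _)] at he
    rw [_root_.inv_zpow, ← one_div, le_div_iff₀ (zpow_pos h0 _), mul_comm] at he'
    rw [Units.val_mul, Units.val_zpow_eq_zpow_val]
    rw [← norm_zpow, ← norm_mul] at he'
    refine le_antisymm he' (not_lt.1 fun h => ?_)
    have h2 := (hϖ _).1 h
    rw [zpow_add_one₀ ϖ.ne_zero, mul_right_comm, norm_mul, norm_mul, norm_zpow] at h2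
    exact absurd ((mul_le_iff_le_one_left h0).1 h2) (not_le.2 he)
  · rw [← mul_assoc, ← _root_.zpow_add]
    simp

variable [LocallyCompactSpace F]

instance : SecondCountableTopology (borelSubgroup m F) :=
  TopologicalSpace.Subtype.secondCountableTopology _

lemma isOpen_integralBorel : IsOpen (integralBorel F m : Set (borelSubgroup m F)) :=
  isOpen_maxCompact.preimage continuous_subtype_val

lemma isCompact_integralBorel : IsCompact (integralBorel F m : Set (borelSubgroup m F)) :=
  isClosed_borelSubgroup.isClosedEmbedding_subtypeVal.isCompact_preimage isCompact_maxCompact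

/-- For A = P ∩ K, the modular character at t is vol(tAt⁻¹)/vol(A). Here tAt⁻¹ is a subgroup of A
whose index is the orbit size q^(k(m-k)). -/
lemma modularCharacter_stepDiag {ϖ : Fˣ} (hϖ : IsUniformizer (ϖ : F))
    (hnorm : ‖(ϖ : F)‖ = (Nat.card (residueField F) : ℝ)⁻¹) {k : ℕ} (hk : k ≤ m) :
    (Measure.modularCharacter (diagBorel (stepDiag m ϖ k)) : ℝ) = ‖(ϖ : F)‖ ^ (k * (m - k)) := by
  let _ : MeasurableSpace (borelSubgroup m F) := borel _
  have : BorelSpace (borelSubgroup m F) := ⟨rfl⟩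
  let μ : Measure (borelSubgroup m F) := Measure.haar
  let t : borelSubgroup m F := diagBorel (stepDiag m ϖ k)
  let A := integralBorel F m
  let T : Subgroup (borelSubgroup m F) := A.comap (MulAut.conj t⁻¹).toMonoidHom
  have hT : (T : Set (borelSubgroup m F)) = (fun x => t⁻¹ * x * t) ⁻¹' A := by
    ext x
    change t⁻¹ * x * t⁻¹⁻¹ ∈ A ↔ t⁻¹ * x * t ∈ A
    rw [inv_inv]
  have hTo : IsOpen (T : Set (borelSubgroup m F)) := by
    rw [hT]
    exact isOpen_integralBorel.preimage (by fun_prop)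
  have hTA : T ≤ A := by
    intro x hx
    have hx' : t⁻¹ * x * t ∈ A := by rwa [← SetLike.mem_coe, hT] at hx
    have h := diagGL_conj_mem_maxCompact
      (stepDiag_antidominant (m := m) ((hϖ _).2 le_rfl).le k) (t⁻¹ * x * t).2 hx'
    have h2 : diagGL (stepDiag m ϖ k) * ((t⁻¹ * x * t : borelSubgroup m F) : GL (Fin m) F) *
        (diagGL (stepDiag m ϖ k))⁻¹ = x := by
      change diagGL (stepDiag m ϖ k) * ((diagGL (stepDiag m ϖ k))⁻¹ * x * diagGL (stepDiag m ϖ k)) *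
        (diagGL (stepDiag m ϖ k))⁻¹ = x
      group
    rwa [h2] at h
  have hstab : T.subgroupOf A =
      @MulAction.stabilizer _ _ _ (conjAction F m) (diagProj m (residueField F) k) := by
    ext x
    rw [← stepDiag_conj_mem_iff hϖ, Subgroup.mem_subgroupOf, ← SetLike.mem_coe, hT]
    rfl
  have hcard : Nat.card (A ⧸ T.subgroupOf A) = Nat.card (residueField F) ^ (k * (m - k)) := by
    let _ := conjAction F m
    rw [← Subgroup.index_eq_card, hstab, MulAction.index_stabilizer, orbit_diagProj, ncard_block hk]
  have h1 := measureReal_eq_card_mul μ hTA isCompact_integralBorel hTo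
  have h2 := measureReal_conj μ t (isOpen_integralBorel (F := F) (m := m)).measurableSet
  have h3 : 0 < μ.real A := measureReal_pos μ isCompact_integralBorel isOpen_integralBorel
  rw [hT, h2, hcard, ← mul_assoc] at h1
  have h4 := mul_right_cancel₀ h3.ne' ((one_mul (μ.real A)).trans h1)
  rw [hnorm, inv_pow]
  push_cast at h4
  exact eq_inv_of_mul_eq_one_right h4.symm

/-- A suitable diagonal matrix conjugates `p` into the compact group P ∩ K, where the modular
character is trivial, and a character into a commutative monoid is unchanged by conjugation. -/
lemma modularCharacter_borel_of_norm_diag_eq_one {ϖ : Fˣ} (hϖ : IsUniformizer (ϖ : F))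
    (p : borelSubgroup m F) (hp : ∀ i, ‖(p : GL (Fin m) F) i i‖ = 1) :
    Measure.modularCharacter p = 1 := by
  have h0 : 0 < ‖(ϖ : F)‖ := norm_pos_iff.2 ϖ.ne_zero
  have h1 : ‖(ϖ : F)‖ < 1 := (hϖ _).2 le_rfl
  obtain ⟨C, hC⟩ : ∃ C : ℝ, ∀ i j, ‖(p : GL (Fin m) F) i j‖ ≤ C ∧
      ‖(p⁻¹ : GL (Fin m) F) i j‖ ≤ C := by
    refine ⟨∑ i, ∑ j, (‖(p : GL (Fin m) F) i j‖ + ‖(p⁻¹ : GL (Fin m) F) i j‖), fun i j => ?_⟩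
    have h : ‖(p : GL (Fin m) F) i j‖ + ‖(p⁻¹ : GL (Fin m) F) i j‖ ≤
        ∑ i, ∑ j, (‖(p : GL (Fin m) F) i j‖ + ‖(p⁻¹ : GL (Fin m) F) i j‖) :=
      (Finset.single_le_sum (f := fun j => ‖(p : GL (Fin m) F) i j‖ + ‖(p⁻¹ : GL (Fin m) F) i j‖)
        (fun _ _ => by positivity) (Finset.mem_univ j)).trans
      (Finset.single_le_sum
        (f := fun i => ∑ j, (‖(p : GL (Fin m) F) i j‖ + ‖(p⁻¹ : GL (Fin m) F) i j‖))
        (fun _ _ => by positivity) (Finset.mem_univ i))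
    constructor <;> linarith [norm_nonneg ((p : GL (Fin m) F) i j),
      norm_nonneg ((p⁻¹ : GL (Fin m) F) i j)]
  -- Conjugating by diag(ϖ^(e i)) shrinks every entry above the diagonal by at least ‖ϖ‖^e, which is
  -- to compensate the bound C; the maximum with 1 ensures positivity.
  obtain ⟨e, he⟩ := exists_pow_lt_of_lt_one (show (0 : ℝ) < (max C 1)⁻¹ by positivity) h1
  have he' : ‖(ϖ : F)‖ ^ e * C ≤ 1 := by
    have h2 : ‖(ϖ : F)‖ ^ e * max C 1 ≤ 1 := by
      rw [← le_div_iff₀ (by positivity), one_div]; exact he.le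
    exact (mul_le_mul_of_nonneg_left (le_max_left C 1) (by positivity)).trans h2
  let d : Fin m → Fˣ := fun i => ϖ ^ (e * (i : ℕ))
  have hpinv : ∀ i, ‖(p⁻¹ : GL (Fin m) F) i i‖ = 1 := fun i => by
    have h := diag_mul_of_mem_borel p.2 (inv_mem p.2) i
    rw [mul_inv_cancel, Units.val_one, one_apply_eq] at h
    have h2 := congrArg norm h
    rwa [norm_one, norm_mul, hp, one_mul, eq_comm] at h2
  have key : ∀ x : GL (Fin m) F, x ∈ borelSubgroup m F → (∀ i, ‖x i i‖ = 1) →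
      (∀ i j, ‖x i j‖ ≤ C) → ∀ i j, ‖((diagGL d)⁻¹ * x * diagGL d) i j‖ ≤ 1 := by
    intro x hx hx1 hxC i j
    rw [diagGL_conj_apply', norm_mul, norm_mul, norm_inv]
    have hdi : 0 < ‖(d i : F)‖ := norm_pos_iff.2 (d i).ne_zero
    rcases lt_trichotomy i j with h | h | h
    · rw [mul_right_comm, inv_mul_eq_div]
      have h2 : ‖(d j : F)‖ / ‖(d i : F)‖ ≤ ‖(ϖ : F)‖ ^ e := by
        rw [div_le_iff₀ hdi]
        simp only [d, Units.val_pow_eq_pow_val, norm_pow]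
        rw [← pow_add]
        refine pow_le_pow_of_le_one h0.le h1.le ?_
        rw [Fin.lt_def] at h
        nlinarith
      exact (mul_le_mul h2 (hxC i j) (norm_nonneg _) (by positivity)).trans he'
    · subst h
      rw [hx1, mul_one, inv_mul_cancel₀ hdi.ne']
    · rw [hx i j h]
      simp
  have hmem : (diagBorel d)⁻¹ * p * diagBorel d ∈ integralBorel F m := by
    change (diagGL d)⁻¹ * (p : GL (Fin m) F) * diagGL d ∈ maxCompact F m
    refine (mem_maxCompact_iff _).2 fun i j => ⟨key _ p.2 hp (fun i j => (hC i j).1) i j, ?_⟩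
    have h2 : ((diagGL d)⁻¹ * (p : GL (Fin m) F) * diagGL d)⁻¹ =
      (diagGL d)⁻¹ * (p⁻¹ : GL (Fin m) F) * diagGL d := by group
    rw [h2]
    exact key _ (inv_mem p.2) hpinv (fun i j => (hC i j).2) i j
  have h := modularCharacter_eq_one_of_mem isCompact_integralBorel isOpen_integralBorel hmem
  rwa [map_mul, map_mul, mul_right_comm, ← map_mul, inv_mul_cancel, map_one, one_mul] at h

lemma diagBorel_apply_self (d : Fin m → Fˣ) (i : Fin m) :
    (diagBorel d : GL (Fin m) F) i i = d i := diagGL_apply_self d i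

/-- The target is only a monoid, such as ℝ under multiplication, so integer powers are taken in the
subgroup where the two maps agree. -/
lemma map_zpow_mul_eq_map_zpow_mul {G M : Type*} [Group G] [Monoid M] {f g : G →* M} {x y : G}
    (hx : f x = g x) (hy : f y = g y) (e : ℤ) : f (x ^ e * y) = g (x ^ e * y) :=
  mul_mem (zpow_mem (show x ∈ f.eqLocus g from hx) e) (show y ∈ f.eqLocus g from hy)

/-- The modular character of the Borel subgroup is `δ`. -/
theorem modularCharacter_borel {ϖ : Fˣ} (hϖ : IsUniformizer (ϖ : F))
    (hnorm : ‖(ϖ : F)‖ = (Nat.card (residueField F) : ℝ)⁻¹) (p : borelSubgroup m F) :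
    (Measure.modularCharacter p : ℝ) = delta (p : GL (Fin m) F) := by
  let φ : borelSubgroup m F →* ℝ := NNReal.toRealHom.toMonoidHom.comp Measure.modularCharacter
  change φ p = deltaHom p
  have hunit : ∀ p : borelSubgroup m F, (∀ i, ‖(p : GL (Fin m) F) i i‖ = 1) →
      φ p = deltaHom p := fun p hp => by
    refine Eq.trans ?_ (delta_eq_one hp).symm
    change ((Measure.modularCharacter p : ℝ≥0) : ℝ) = 1
    rw [modularCharacter_borel_of_norm_diag_eq_one hϖ p hp, NNReal.coe_one]
  have hdiag : φ.comp diagBorel = deltaHom.comp (diagBorel (F := F) (m := m)) := by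
    refine MonoidHom.pi_ext fun i x => ?_
    obtain ⟨e, u, hu, rfl⟩ := exists_norm_eq_zpow hϖ x
    have h1 : φ (diagBorel (Pi.mulSingle i ϖ)) = deltaHom (diagBorel (Pi.mulSingle i ϖ)) := by
      have hstep : ∀ k, k ≤ m →
          φ (diagBorel (stepDiag m ϖ k)) = deltaHom (diagBorel (stepDiag m ϖ k)) := fun k hk =>
        (modularCharacter_stepDiag hϖ hnorm hk).trans (delta_stepDiag ϖ hk).symm
      -- Quotients of consecutive step elements isolate a uniformizer in a single coordinate.
      have hs : stepDiag m ϖ (i + 1) = stepDiag m ϖ i * Pi.mulSingle i ϖ := by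
        ext j
        rw [Pi.mul_apply, Pi.mulSingle_apply]
        simp only [stepDiag]
        rcases lt_trichotomy j i with h | h | h
        · rw [if_pos (by rw [Fin.lt_def] at h; omega), if_pos (by exact h), if_neg h.ne, mul_one]
        · subst h
          simp
        · rw [if_neg (by rw [Fin.lt_def] at h; omega), if_neg (by rw [Fin.lt_def] at h; omega), if_neg h.ne', mul_one]
      have h2 := hstep (i + 1) i.2
      rw [hs, map_mul, map_mul, map_mul, hstep i i.2.le] at h2
      exact mul_left_cancel₀ (delta_pos (diagBorel _).2).ne' h2
    have h2 : φ (diagBorel (Pi.mulSingle i u)) = deltaHom (diagBorel (Pi.mulSingle i u)) := by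
      refine hunit _ fun j => ?_
      rw [diagBorel_apply_self, Pi.mulSingle_apply]
      split_ifs
      · exact hu
      · simp
    have h3 : (Pi.mulSingle i (ϖ ^ e * u) : Fin m → Fˣ) =
        Pi.mulSingle i ϖ ^ e * Pi.mulSingle i u := by
      rw [Pi.mulSingle_mul, Pi.mulSingle_zpow]
    rw [h3]
    exact map_zpow_mul_eq_map_zpow_mul (f := φ.comp diagBorel) (g := deltaHom.comp diagBorel) h1 h2 e
  let d : Fin m → Fˣ := fun i => Units.mk0 _ (diag_ne_zero p.2 i)
  have h1 : φ (diagBorel d) = deltaHom (diagBorel d) := DFunLike.congr_fun hdiag d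
  -- Dividing `p` by its diagonal part leaves a unipotent matrix.
  have h2 := hunit ((diagBorel d)⁻¹ * p) fun i => by
    have h3 : ((diagBorel d)⁻¹ * p : borelSubgroup m F) = diagBorel d⁻¹ * p := by rw [map_inv]
    rw [h3, Subgroup.coe_mul, diag_mul_of_mem_borel (diagBorel _).2 p.2, diagBorel_apply_self]
    simp [d, diag_ne_zero p.2 i]
  rw [← mul_inv_cancel_left (diagBorel d) p, map_mul φ, map_mul deltaHom, h1, h2]

end BorelModular

/-! ### Test functions -/

section TestSpace

variable {F : Type*} [NontriviallyNormedField F] [IsUltrametricDist F] {m : ℕ}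

/-- The space of compactly supported functions that are invariant, on both sides, under translation
by a neighbourhood of the identity. -/
def testSpace (F : Type*) [NontriviallyNormedField F] (m : ℕ) :
    Submodule ℂ (GL (Fin m) F → ℂ) where
  carrier := {f | HasCompactSupport f ∧
    ∀ᶠ u in nhds (1 : GL (Fin m) F), ∀ x, f (u * x) = f x ∧ f (x * u) = f x}
  add_mem' {f₁ f₂} h₁ h₂ := ⟨h₁.1.add h₂.1, by
    filter_upwards [h₁.2, h₂.2] with u hu₁ hu₂ x
    simp only [Pi.add_apply, hu₁ x, hu₂ x, and_self]⟩
  zero_mem' := ⟨HasCompactSupport.zero, .of_forall fun _ _ => ⟨rfl, rfl⟩⟩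
  smul_mem' c f h := ⟨h.1.smul_left (f := fun _ => c), by
    filter_upwards [h.2] with u hu x
    simp only [Pi.smul_apply, hu x, and_self]⟩

lemma isLocallyConstant_of_mem_testSpace {f : GL (Fin m) F → ℂ} (hf : f ∈ testSpace F m) :
    IsLocallyConstant f := by
  refine (IsLocallyConstant.iff_eventually_eq f).2 fun x => ?_
  have ht : Filter.Tendsto (fun y : GL (Fin m) F => x⁻¹ * y) (nhds x) (nhds 1) := by
    have := (continuous_const_mul x⁻¹).tendsto x
    rwa [inv_mul_cancel] at this
  filter_upwards [ht hf.2] with y hy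
  have := (hy x).2
  rwa [mul_inv_cancel_left] at this

lemma eventually_conj {G : Type*} [Group G] [TopologicalSpace G] [IsTopologicalGroup G]
    {q : G → Prop} (hq : ∀ᶠ u in nhds 1, q u) (g : G) : ∀ᶠ u in nhds 1, q (g * u * g⁻¹) := by
  have hc : Continuous fun u : G => g * u * g⁻¹ := by fun_prop
  have := hc.tendsto 1
  rw [mul_one, mul_inv_cancel] at this
  exact this hq

/-- Left translation of test functions, `(L_g f)(y) = f(g⁻¹ y)`. -/
def leftT (g : GL (Fin m) F) : testSpace F m →ₗ[ℂ] testSpace F m where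
  toFun f := ⟨fun y => f.1 (g⁻¹ * y), f.2.1.comp_homeomorph (Homeomorph.mulLeft g⁻¹), by
    filter_upwards [f.2.2, eventually_conj f.2.2 g⁻¹] with u hu hu' x
    refine ⟨?_, ?_⟩
    · have h := (hu' (g⁻¹ * x)).1
      simp only [mul_assoc, mul_inv_cancel_left, inv_inv] at h
      exact h
    · rw [← mul_assoc]
      exact (hu _).2⟩
  map_add' _ _ := rfl
  map_smul' _ _ := rfl

/-- Right translation of test functions, `(R_g f)(y) = f(y g)`. -/
def rightT (g : GL (Fin m) F) : testSpace F m →ₗ[ℂ] testSpace F m where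
  toFun f := ⟨rightTrans g f.1, f.2.1.comp_homeomorph (Homeomorph.mulRight g), by
    filter_upwards [f.2.2, eventually_conj f.2.2 g⁻¹] with u hu hu' x
    refine ⟨?_, ?_⟩
    · unfold rightTrans
      rw [mul_assoc]
      exact (hu _).1
    · have h := (hu' (x * g)).2
      simp only [← mul_assoc, mul_inv_cancel_right, inv_inv] at h
      exact h⟩
  map_add' _ _ := rfl
  map_smul' _ _ := rfl

lemma leftT_apply (g : GL (Fin m) F) (f : testSpace F m) (y : GL (Fin m) F) :
    (leftT g f).1 y = f.1 (g⁻¹ * y) := rfl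

lemma rightT_apply (g : GL (Fin m) F) (f : testSpace F m) (y : GL (Fin m) F) :
    (rightT g f).1 y = f.1 (y * g) := rfl

lemma leftT_leftT (g h : GL (Fin m) F) (f : testSpace F m) :
    leftT g (leftT h f) = leftT (g * h) f :=
  Subtype.ext (funext fun y => by simp only [leftT_apply, _root_.mul_inv_rev, mul_assoc])

lemma leftT_rightT (g h : GL (Fin m) F) (f : testSpace F m) :
    leftT g (rightT h f) = rightT h (leftT g f) :=
  Subtype.ext (funext fun y => by simp only [leftT_apply, rightT_apply, mul_assoc])

lemma rightT_one (f : testSpace F m) : rightT 1 f = f :=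
  Subtype.ext (funext fun y => by rw [rightT_apply, mul_one])

/-- The indicator function of an open compact subgroup. -/
def indicatorT (C : Subgroup (GL (Fin m) F)) (hC : IsOpen (C : Set (GL (Fin m) F)))
    (hC' : IsCompact (C : Set (GL (Fin m) F))) : testSpace F m :=
  ⟨(C : Set (GL (Fin m) F)).indicator 1,
    HasCompactSupport.intro hC' fun _ hx => Set.indicator_of_notMem hx _, by
    filter_upwards [hC.mem_nhds (one_mem C)] with u hu x
    constructor
    · by_cases hx : x ∈ C
      · rw [Set.indicator_of_mem hx, Set.indicator_of_mem (mul_mem hu hx)]; rfl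
      · rw [Set.indicator_of_notMem hx,
          Set.indicator_of_notMem fun h => hx ((Subgroup.mul_mem_cancel_left _ hu).1 h)]
    · by_cases hx : x ∈ C
      · rw [Set.indicator_of_mem hx, Set.indicator_of_mem (mul_mem hx hu)]; rfl
      · rw [Set.indicator_of_notMem hx,
          Set.indicator_of_notMem fun h => hx ((Subgroup.mul_mem_cancel_right _ hu).1 h)]⟩

lemma leftT_indicatorT {C : Subgroup (GL (Fin m) F)} (hC : IsOpen (C : Set (GL (Fin m) F)))
    (hC' : IsCompact (C : Set (GL (Fin m) F))) {g h : GL (Fin m) F} (hgh : g⁻¹ * h ∈ C) :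
    leftT g (indicatorT C hC hC') = leftT h (indicatorT C hC hC') := by
  refine Subtype.ext (funext fun y => ?_)
  change (C : Set (GL (Fin m) F)).indicator 1 (g⁻¹ * y) =
    (C : Set (GL (Fin m) F)).indicator 1 (h⁻¹ * y)
  have : g⁻¹ * y ∈ (C : Set (GL (Fin m) F)) ↔ h⁻¹ * y ∈ (C : Set (GL (Fin m) F)) := by
    have h1 : g⁻¹ * y = g⁻¹ * h * (h⁻¹ * y) := by group
    rw [h1, SetLike.mem_coe, Subgroup.mul_mem_cancel_left _ hgh, SetLike.mem_coe]
  by_cases hy : h⁻¹ * y ∈ (C : Set (GL (Fin m) F))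
  · rw [Set.indicator_of_mem hy, Set.indicator_of_mem (this.2 hy)]; rfl
  · rw [Set.indicator_of_notMem hy, Set.indicator_of_notMem (fun h' => hy (this.1 h'))]

lemma rightT_indicatorT {C : Subgroup (GL (Fin m) F)} (hC : IsOpen (C : Set (GL (Fin m) F)))
    (hC' : IsCompact (C : Set (GL (Fin m) F))) {g h : GL (Fin m) F} (hgh : h⁻¹ * g ∈ C) :
    rightT g (indicatorT C hC hC') = rightT h (indicatorT C hC hC') := by
  refine Subtype.ext (funext fun y => ?_)
  change (C : Set (GL (Fin m) F)).indicator 1 (y * g) =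
    (C : Set (GL (Fin m) F)).indicator 1 (y * h)
  have : y * g ∈ (C : Set (GL (Fin m) F)) ↔ y * h ∈ (C : Set (GL (Fin m) F)) := by
    have h1 : y * g = y * h * (h⁻¹ * g) := by group
    rw [h1, SetLike.mem_coe, Subgroup.mul_mem_cancel_right _ hgh, SetLike.mem_coe]
  by_cases hy : y * h ∈ (C : Set (GL (Fin m) F))
  · rw [Set.indicator_of_mem hy, Set.indicator_of_mem (this.2 hy)]; rfl
  · rw [Set.indicator_of_notMem hy, Set.indicator_of_notMem (fun h' => hy (this.1 h'))]

/-! ### The projection to the principal series -/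

lemma continuous_chiDeltaHalf (z : Fin m → ℂ) :
    Continuous fun p : borelSubgroup m F => chiDeltaHalf z (p : GL (Fin m) F) := by
  have hc : ∀ i : Fin m, Continuous fun p : borelSubgroup m F => ‖(p : GL (Fin m) F) i i‖ :=
    fun i => ((continuous_apply_GL i i).comp continuous_subtype_val).norm
  have h0 : ∀ (i : Fin m) (p : borelSubgroup m F), 0 < ‖(p : GL (Fin m) F) i i‖ := fun i p =>
    norm_pos_iff.2 (diag_ne_zero p.2 i)
  unfold chiDeltaHalf unramChar delta
  refine (continuous_finsetProd _ fun i _ => ?_).mul (Complex.continuous_ofReal.comp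
    (Real.continuous_sqrt.comp (continuous_finsetProd _ fun i _ => ?_)))
  · exact (Complex.continuous_ofReal.comp (hc i)).cpow continuous_const fun p =>
      Complex.ofReal_mem_slitPlane.2 (h0 i p)
  · exact (hc i).zpow₀ _ fun p => Or.inl (h0 i p).ne'

lemma chiDeltaHalf_neg_mul (z : Fin m → ℂ) {p : GL (Fin m) F} (hp : p ∈ borelSubgroup m F) :
    chiDeltaHalf (-z) p * chiDeltaHalf z p = delta p := by
  have h1 : unramChar (-z) p * unramChar z p = 1 := by
    unfold unramChar
    rw [← Finset.prod_mul_distrib]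
    refine Finset.prod_eq_one fun i _ => ?_
    rw [← Complex.cpow_add _ _ (Complex.ofReal_ne_zero.2 (norm_ne_zero_iff.2 (diag_ne_zero hp i))),
      Pi.neg_apply, neg_add_cancel, Complex.cpow_zero]
  have h2 : (Real.sqrt (delta p) : ℂ) * Real.sqrt (delta p) = delta p := by
    rw [← Complex.ofReal_mul, Real.mul_self_sqrt (delta_pos hp).le]
  calc _ = (unramChar (-z) p * unramChar z p) *
      ((Real.sqrt (delta p) : ℂ) * Real.sqrt (delta p)) := by unfold chiDeltaHalf; ring
    _ = _ := by rw [h1, h2, one_mul]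

variable [LocallyCompactSpace F] [MeasurableSpace (GL (Fin m) F)] [BorelSpace (GL (Fin m) F)]
  (μP : Measure (borelSubgroup m F)) [μP.IsHaarMeasure]

lemma integrable_Pchi (z : Fin m → ℂ) {f : GL (Fin m) F → ℂ} (hf : f ∈ testSpace F m)
    (g : GL (Fin m) F) :
    Integrable (fun p : borelSubgroup m F => chiDeltaHalf z (p : GL (Fin m) F) * f (p * g)) μP := by
  have hf' := (isLocallyConstant_of_mem_testSpace hf).continuous
  have hc : Continuous fun p : borelSubgroup m F => f (p * g) :=
    hf'.comp (continuous_subtype_val.mul continuous_const)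
  have hs : HasCompactSupport fun p : borelSubgroup m F => f (p * g) :=
    hf.1.comp_isClosedEmbedding ((Homeomorph.mulRight g).isClosedEmbedding.comp
      isClosed_borelSubgroup.isClosedEmbedding_subtypeVal)
  exact ((continuous_chiDeltaHalf z).mul hc).integrable_of_hasCompactSupport hs.mul_left

/-- Replacing p by p p₀⁻¹ in the integral costs χδ^{-1/2}(p₀) from the integrand and δ(p₀) from the
left Haar measure, together χδ^{1/2}(p₀). Local constancy follows from the uniform right invariance
of `f`. -/
lemma Pchi_mem {ϖ : Fˣ} (hϖ : IsUniformizer (ϖ : F))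
    (hnorm : ‖(ϖ : F)‖ = (Nat.card (residueField F) : ℝ)⁻¹) (z : Fin m → ℂ)
    {f : GL (Fin m) F → ℂ} (hf : f ∈ testSpace F m) : Pchi μP z f ∈ principalSeries z := by
  refine ⟨(IsLocallyConstant.iff_eventually_eq _).2 fun x => ?_, fun p₀ hp₀ g => ?_⟩
  · have ht : Filter.Tendsto (fun y : GL (Fin m) F => x⁻¹ * y) (nhds x) (nhds 1) := by
      have := (continuous_const_mul x⁻¹).tendsto x
      rwa [inv_mul_cancel] at this
    filter_upwards [ht hf.2] with y hy
    unfold Pchi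
    congr 1
    funext p
    have := (hy (p * x)).2
    rw [mul_assoc, mul_inv_cancel_left] at this
    rw [this]
  · let q : borelSubgroup m F := ⟨p₀, hp₀⟩
    let h : borelSubgroup m F → ℂ := fun p =>
      chiDeltaHalf (-z) (q⁻¹ : GL (Fin m) F) * (chiDeltaHalf (-z) (p : GL (Fin m) F) * f (p * g))
    have h1 : ∀ p : borelSubgroup m F,
        chiDeltaHalf (-z) (p : GL (Fin m) F) * f (p * (p₀ * g)) = h (p * q) := fun p => by
      have h2 := chiDeltaHalf_mul (-z) (mul_mem p.2 hp₀) (inv_mem hp₀)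
      rw [mul_inv_cancel_right] at h2
      simp only [h, Subgroup.coe_mul, q]
      rw [h2, ← mul_assoc (p : GL (Fin m) F)]
      ring
    have h2 : ∫ p, h (p * q) ∂μP = ∫ p, h p ∂(μP.map (· * q)) :=
      ((Homeomorph.mulRight q).measurableEmbedding.integral_map h).symm
    have h3 : chiDeltaHalf (-z) p₀ * chiDeltaHalf (-z) p₀⁻¹ = 1 := by
      rw [← chiDeltaHalf_mul (-z) hp₀ (inv_mem hp₀), mul_inv_cancel]
      exact chiDeltaHalf_eq_one _ fun i => by simp
    simp only [Pchi, h1]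
    rw [h2, map_mul_right_eq_modularCharacter_smul, integral_smul_nnreal_measure, NNReal.smul_def,
      modularCharacter_borel hϖ hnorm, integral_const_mul, Complex.real_smul,
      ← chiDeltaHalf_neg_mul z hp₀]
    linear_combination (chiDeltaHalf z p₀ * ∫ p : borelSubgroup m F,
      chiDeltaHalf (-z) (p : GL (Fin m) F) * f (p * g) ∂μP) * h3

/-- The map `𝒫_χ` as a linear map from test functions to the principal series. -/
def PchiLin {ϖ : Fˣ} (hϖ : IsUniformizer (ϖ : F))
    (hnorm : ‖(ϖ : F)‖ = (Nat.card (residueField F) : ℝ)⁻¹) (z : Fin m → ℂ) :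
    testSpace F m →ₗ[ℂ] principalSeries (F := F) z where
  toFun f := ⟨Pchi μP z f.1, Pchi_mem μP hϖ hnorm z f.2⟩
  map_add' f₁ f₂ := Subtype.ext <| funext fun g => by
    change ∫ p, _ * (f₁.1 _ + f₂.1 _) ∂μP = ∫ p, _ ∂μP + ∫ p, _ ∂μP
    simp_rw [mul_add]
    exact integral_add (integrable_Pchi μP _ f₁.2 g) (integrable_Pchi μP _ f₂.2 g)
  map_smul' c f := Subtype.ext <| funext fun g => by
    change ∫ p, _ * (c * f.1 _) ∂μP = c * ∫ p, _ ∂μP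
    rw [← integral_const_mul]
    congr 1
    funext p
    ring

/-- On test functions the default value 0 of `extendZero` never intervenes. -/
lemma distribution_eq {ϖ : Fˣ} (hϖ : IsUniformizer (ϖ : F))
    (hnorm : ‖(ϖ : F)‖ = (Nat.card (residueField F) : ℝ)⁻¹) {z : Fin m → ℂ}
    (Λ : principalSeries (F := F) z →ₗ[ℂ] ℂ) (f : testSpace F m) :
    distribution μP Λ f.1 = Λ (PchiLin μP hϖ hnorm z f) := by
  unfold distribution extendZero
  rw [dif_pos (Pchi_mem μP hϖ hnorm z f.2)]
  rfl

lemma PchiLin_leftT {ϖ : Fˣ} (hϖ : IsUniformizer (ϖ : F))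
    (hnorm : ‖(ϖ : F)‖ = (Nat.card (residueField F) : ℝ)⁻¹) (z : Fin m → ℂ) {p : GL (Fin m) F}
    (hp : p ∈ borelSubgroup m F) (f : testSpace F m) :
    PchiLin μP hϖ hnorm z (leftT p f) = chiDeltaHalf (-z) p • PchiLin μP hϖ hnorm z f :=
  Subtype.ext (Pchi_left μP z f.1 hp)

lemma PchiLin_rightT {ϖ : Fˣ} (hϖ : IsUniformizer (ϖ : F))
    (hnorm : ‖(ϖ : F)‖ = (Nat.card (residueField F) : ℝ)⁻¹) (z : Fin m → ℂ) (g : GL (Fin m) F)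
    (f : testSpace F m) :
    PchiLin μP hϖ hnorm z (rightT g f) = R g (PchiLin μP hϖ hnorm z f) := by
  refine Subtype.ext (funext fun x => ?_)
  change ∫ p, _ * f.1 _ ∂μP = ∫ p, _ * f.1 _ ∂μP
  simp only [mul_assoc]

end TestSpace

/-! ### Functionals with equivariance under `P` and `H` -/

section Equivariant

variable {F : Type*} [NontriviallyNormedField F] [IsUltrametricDist F] [LocallyCompactSpace F]

/-- The indicator function of the Iwahori subgroup. -/
def iwahoriT (F : Type*) [NontriviallyNormedField F] [IsUltrametricDist F] [LocallyCompactSpace F]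
    (m : ℕ) : testSpace F m :=
  indicatorT (iwahori F m) isOpen_iwahori isCompact_iwahori

/-- The conjugate `d⁻¹ B d` of the Iwahori subgroup by a diagonal matrix. -/
def conjIwahori {m : ℕ} (d : Fin m → Fˣ) : Subgroup (GL (Fin m) F) :=
  (iwahori F m).comap (MulAut.conj (diagGL d)).toMonoidHom

lemma mem_conjIwahori {m : ℕ} {d : Fin m → Fˣ} {x : GL (Fin m) F} :
    x ∈ conjIwahori d ↔ diagGL d * x * (diagGL d)⁻¹ ∈ iwahori F m := Iff.rfl

lemma isOpen_conjIwahori {m : ℕ} (d : Fin m → Fˣ) :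
    IsOpen (conjIwahori d : Set (GL (Fin m) F)) :=
  isOpen_iwahori.preimage (f := fun x : GL (Fin m) F => diagGL d * x * (diagGL d)⁻¹) (by fun_prop)

lemma isCompact_conjIwahori {m : ℕ} (d : Fin m → Fˣ) :
    IsCompact (conjIwahori d : Set (GL (Fin m) F)) := by
  have h := isCompact_iwahori.image (f := fun x : GL (Fin m) F => (diagGL d)⁻¹ * x * diagGL d)
    (by fun_prop)
  convert h using 1
  ext x
  rw [SetLike.mem_coe, mem_conjIwahori, Set.mem_image]
  constructor
  · exact fun hx => ⟨_, hx, by group⟩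
  · rintro ⟨y, hy, rfl⟩
    have h1 : diagGL d * ((diagGL d)⁻¹ * y * diagGL d) * (diagGL d)⁻¹ = y := by group
    rwa [h1]

/-- Conjugation by a diagonal matrix preserves Haar measure, so both groups have the same volume;
each index is that volume divided by the volume of the intersection. -/
lemma index_iwahori_eq {m : ℕ} (d : Fin m → Fˣ) :
    Nat.card (iwahori F m ⧸ (iwahori F m ⊓ conjIwahori d).subgroupOf (iwahori F m)) =
      Nat.card (conjIwahori d ⧸ (iwahori F m ⊓ conjIwahori d).subgroupOf (conjIwahori d)) := by
  borelize (GL (Fin m) F)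
  let μ : Measure (GL (Fin m) F) := Measure.haar
  have hC : IsOpen ((iwahori F m ⊓ conjIwahori d : Subgroup _) : Set (GL (Fin m) F)) :=
    isOpen_iwahori.inter (isOpen_conjIwahori d)
  have hC' : IsCompact ((iwahori F m ⊓ conjIwahori d : Subgroup _) : Set (GL (Fin m) F)) :=
    isCompact_iwahori.inter_right (Subgroup.isClosed_of_isOpen _ (isOpen_conjIwahori d))
  have h1 := measureReal_eq_card_mul μ inf_le_left isCompact_iwahori hC
  have h2 := measureReal_eq_card_mul μ inf_le_right (isCompact_conjIwahori d) hC
  have h3 := measureReal_conj μ (diagGL d⁻¹) (isOpen_iwahori (F := F) (m := m)).measurableSet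
  rw [modularCharacter_diagGL, NNReal.coe_one, one_mul] at h3
  have h4 : (fun x : GL (Fin m) F => (diagGL d⁻¹)⁻¹ * x * diagGL d⁻¹) ⁻¹' iwahori F m =
      (conjIwahori d : Set (GL (Fin m) F)) := by
    rw [map_inv, inv_inv]; rfl
  rw [h4, h1, h2] at h3
  exact_mod_cast (mul_right_cancel₀ (measureReal_pos μ hC' hC).ne' h3).symm

/-- The factorization `d⁻¹ B d = (d⁻¹ (P ∩ K) d) (B ∩ d⁻¹ B d)`. -/
lemma exists_borel_mul_of_mem_conjIwahori {m : ℕ} {d : Fin m → Fˣ}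
    (hd : ∀ i j, i ≤ j → ‖(d i : F)‖ ≤ ‖(d j : F)‖) {x : GL (Fin m) F} (hx : x ∈ conjIwahori d) :
    ∃ p ∈ borelSubgroup m F, (∀ i, ‖p i i‖ = 1) ∧
      ∃ c ∈ iwahori F m ⊓ conjIwahori d, x = p * c := by
  obtain ⟨p, hp, hp', v, hv, hv1, hv2, h⟩ := exists_borel_mul_lower (mem_conjIwahori.1 hx)
  -- The lower triangular factor contracts back into B. The upper one may leave K, but conjugation
  -- keeps its diagonal, and χδ^{1/2} sees nothing else.
  refine ⟨(diagGL d)⁻¹ * p * diagGL d,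
    mul_mem (mul_mem (inv_mem (diagGL_mem_borel d)) hp) (diagGL_mem_borel d), fun i => ?_,
    (diagGL d)⁻¹ * v * diagGL d, ⟨diagGL_inv_conj_mem_iwahori hd hv hv1 hv2, ?_⟩, ?_⟩
  · rw [diagGL_conj_apply', mul_right_comm, inv_mul_cancel₀ (d i).ne_zero, one_mul,
      norm_diag_eq_one hp hp']
  · have h1 : diagGL d * ((diagGL d)⁻¹ * v * diagGL d) * (diagGL d)⁻¹ = v := by group
    exact mem_conjIwahori.2 (by rwa [h1])
  · have h1 : x = (diagGL d)⁻¹ * (diagGL d * x * (diagGL d)⁻¹) * diagGL d := by group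
    rw [h1, h]
    group

variable {n : ℕ} {ψ : AddChar F ℂ} {z : Fin (n + n) → ℂ}

/-- The core of the proof. The indicators of B and of J = d⁻¹Bd are both cut into translates of that
of C = B ∩ J: right translates by H for B, left translates by P for J. Every translate has the same
value under D, and the numbers of translates agree. -/
lemma apply_rightT_iwahoriT (hψ : HasConductorIntegers ψ) (D : testSpace F (n + n) →ₗ[ℂ] ℂ)
    (hP : ∀ p ∈ borelSubgroup (n + n) F, ∀ f, D (leftT p f) = chiDeltaHalf z p * D f)
    (hH : ∀ h ∈ conjShalika n F, ∀ f, D (rightT h f) = conjShalikaChar ψ h * D f)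
    {d : Fin (n + n) → Fˣ} (hd : ∀ i j, i ≤ j → ‖(d i : F)‖ ≤ ‖(d j : F)‖) :
    D (rightT (diagGL d)⁻¹ (iwahoriT F (n + n))) =
      chiDeltaHalf z (diagGL d) * D (iwahoriT F (n + n)) := by
  let B := iwahori F (n + n)
  let J := conjIwahori d
  have hC : IsOpen ((B ⊓ J : Subgroup _) : Set (GL (Fin (n + n)) F)) :=
    isOpen_iwahori.inter (isOpen_conjIwahori d)
  have hC' : IsCompact ((B ⊓ J : Subgroup _) : Set (GL (Fin (n + n)) F)) :=
    isCompact_iwahori.inter_right (Subgroup.isClosed_of_isOpen _ (isOpen_conjIwahori d))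
  let jT : testSpace F (n + n) := indicatorT J (isOpen_conjIwahori d) (isCompact_conjIwahori d)
  let cT : testSpace F (n + n) := indicatorT (B ⊓ J) hC hC'
  have hcard := index_iwahori_eq d
  have := finite_quotient_subgroupOf isCompact_iwahori hC
  have := finite_quotient_subgroupOf (isCompact_conjIwahori d) hC
  let _ := Fintype.ofFinite (B ⧸ (B ⊓ J).subgroupOf B)
  let _ := Fintype.ofFinite (J ⧸ (B ⊓ J).subgroupOf J)
  have hB : D (iwahoriT F (n + n)) = Nat.card (B ⧸ (B ⊓ J).subgroupOf B) * D cT := by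
    have h1 : iwahoriT F (n + n) = ∑ q : B ⧸ (B ⊓ J).subgroupOf B, rightT q.out.1 cT := by
      refine Subtype.ext (funext fun x => ?_)
      rw [Submodule.coe_sum, Finset.sum_apply]
      exact indicator_eq_sum_right_cosets inf_le_left x
    rw [h1, map_sum, Finset.sum_congr rfl fun q _ => ?_, Finset.sum_const, Finset.card_univ,
      ← Nat.card_eq_fintype_card, nsmul_eq_mul]
    -- Factoring the inverse writes the representative as `h⁻¹ * p⁻¹`. Since P ∩ K lies in C, the
    -- factor `p⁻¹` is absorbed by the indicator of C.
    obtain ⟨p, hp, hp', h, hh, -, hb⟩ := exists_borel_mul_conjShalika hψ (inv_mem q.out.2)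
    have hpB : p ∈ B := mem_iwahori_of_mem_borel hp hp'
    have hpJ : p ∈ J := mem_iwahori_of_mem_borel
      (mul_mem (mul_mem (diagGL_mem_borel d) hp) (inv_mem (diagGL_mem_borel d)))
      (diagGL_conj_mem_maxCompact hd hp hp')
    have hhB : h⁻¹ ∈ B := by
      have h2 : h⁻¹ = q.out.1 * p := by
        rw [← _root_.inv_inj, _root_.mul_inv_rev, hb, inv_inv, inv_mul_cancel_left]
      rw [h2]
      exact mul_mem q.out.2 hpB
    have h2 : rightT q.out.1 cT = rightT h⁻¹ cT := by
      refine rightT_indicatorT hC hC' ?_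
      have h3 : h⁻¹⁻¹ * q.out.1 = p⁻¹ := by
        rw [inv_inv, ← inv_inv q.out.1, hb]
        group
      rw [h3]
      exact inv_mem ⟨hpB, hpJ⟩
    rw [h2, hH _ (inv_mem hh), conjShalikaChar_eq_one_of_mul hψ (one_mem _) (inv_mem hh)
      (by rwa [one_mul]), one_mul]
  have hJ : D jT = Nat.card (J ⧸ (B ⊓ J).subgroupOf J) * D cT := by
    have h1 : jT = ∑ q : J ⧸ (B ⊓ J).subgroupOf J, leftT q.out.1 cT := by
      refine Subtype.ext (funext fun x => ?_)
      rw [Submodule.coe_sum, Finset.sum_apply]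
      exact indicator_eq_sum_cosets inf_le_right x
    rw [h1, map_sum, Finset.sum_congr rfl fun q _ => ?_, Finset.sum_const, Finset.card_univ,
      ← Nat.card_eq_fintype_card, nsmul_eq_mul]
    -- The coset of the representative is `p C`, and `p` has unit diagonal.
    obtain ⟨p, hp, hp', c, hc, hj⟩ := exists_borel_mul_of_mem_conjIwahori hd q.out.2
    have h2 : leftT q.out.1 cT = leftT p cT := by
      refine leftT_indicatorT hC hC' ?_
      rw [hj, _root_.mul_inv_rev, inv_mul_cancel_right]
      exact inv_mem hc
    rw [h2, hP p hp, chiDeltaHalf_eq_one z hp', one_mul]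
  -- Both sides are the indicator of Bd = dJ.
  have hg : rightT (diagGL d)⁻¹ (iwahoriT F (n + n)) = leftT (diagGL d) jT := by
    refine Subtype.ext (funext fun y => ?_)
    change (iwahori F (n + n) : Set (GL (Fin (n + n)) F)).indicator 1 (y * (diagGL d)⁻¹) =
      (J : Set (GL (Fin (n + n)) F)).indicator 1 ((diagGL d)⁻¹ * y)
    have h1 : y * (diagGL d)⁻¹ = diagGL d * ((diagGL d)⁻¹ * y) * (diagGL d)⁻¹ := by group
    rw [h1]
    by_cases hy : (diagGL d)⁻¹ * y ∈ J
    · rw [Set.indicator_of_mem hy, Set.indicator_of_mem (mem_conjIwahori.1 hy)]; rfl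
    · rw [Set.indicator_of_notMem hy,
        Set.indicator_of_notMem (fun h' => hy (mem_conjIwahori.2 h'))]
  rw [hg, hP _ (diagGL_mem_borel d), hJ, ← hcard, ← hB]

/-- The translate of the Iwahori subgroup by an antidominant element lies in the open orbit. -/
lemma mul_diagGL_mem_openOrbit (hψ : HasConductorIntegers ψ) {d : Fin (n + n) → Fˣ}
    (hd : ∀ i j, i ≤ j → ‖(d i : F)‖ ≤ ‖(d j : F)‖) {b : GL (Fin (n + n)) F}
    (hb : b ∈ iwahori F (n + n)) : b * diagGL d ∈ openOrbit n F := by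
  have hx : (diagGL d)⁻¹ * b * diagGL d ∈ conjIwahori d := by
    rw [mem_conjIwahori]
    convert hb using 1
    group
  obtain ⟨p, hp, -, c, hc, h⟩ := exists_borel_mul_of_mem_conjIwahori hd hx
  obtain ⟨p', hp', -, h', hh', -, rfl⟩ := exists_borel_mul_conjShalika hψ hc.1
  refine ⟨(⟨diagGL d * p * p', mul_mem (mul_mem (diagGL_mem_borel d) hp) hp'⟩, ⟨h', hh'⟩), ?_⟩
  have h1 : b * diagGL d = diagGL d * ((diagGL d)⁻¹ * b * diagGL d) := by group
  rw [h1, h]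
  simp only [mul_assoc]

end Equivariant

/-! ### Matrix coefficients -/

section Coefficients

variable {F : Type*} [NontriviallyNormedField F] [IsUltrametricDist F] {m : ℕ} {z : Fin m → ℂ}

/-- The element `x ↦ D(L_x f)` of the principal series that is attached to a left
`P`-equivariant functional `D` and a test function `f`. -/
def leftCoeff (D : testSpace F m →ₗ[ℂ] ℂ)
    (hD : ∀ p ∈ borelSubgroup m F, ∀ f, D (leftT p f) = chiDeltaHalf z p * D f) :
    testSpace F m →ₗ[ℂ] principalSeries (F := F) z where
  toFun f := ⟨fun x => D (leftT x f), by
    refine ⟨(IsLocallyConstant.iff_eventually_eq _).2 fun x => ?_, fun p hp x => ?_⟩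
    · have ht : Filter.Tendsto (fun y : GL (Fin m) F => x⁻¹ * y) (nhds x) (nhds 1) := by
        have := (continuous_const_mul x⁻¹).tendsto x
        rwa [inv_mul_cancel] at this
      filter_upwards [ht f.2.2] with y hy
      have h : leftT (x⁻¹ * y) f = f := by
        refine Subtype.ext (funext fun a => ?_)
        have h1 := (hy ((x⁻¹ * y)⁻¹ * a)).1
        rw [mul_inv_cancel_left] at h1
        exact h1.symm
      have h2 := congrArg (fun f => D (leftT x f)) h
      simp only [leftT_leftT, mul_inv_cancel_left] at h2
      exact h2
    · change D (leftT (p * x) f) = _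
      rw [← leftT_leftT, hD p hp]⟩
  map_add' f₁ f₂ := Subtype.ext (funext fun x => by
    change D (leftT x (f₁ + f₂)) = D (leftT x f₁) + D (leftT x f₂)
    rw [map_add, map_add])
  map_smul' c f := Subtype.ext (funext fun x => by
    change D (leftT x (c • f)) = c • D (leftT x f)
    rw [map_smul, map_smul])

/-- Left translation of `f` becomes the group action on the principal series, which commutes with
T_w; right translation remains free to carry the equivariance under H. -/
lemma leftCoeff_leftT (D : testSpace F m →ₗ[ℂ] ℂ)
    (hD : ∀ p ∈ borelSubgroup m F, ∀ f, D (leftT p f) = chiDeltaHalf z p * D f)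
    (g : GL (Fin m) F) (f : testSpace F m) :
    leftCoeff D hD (leftT g f) = R g (leftCoeff D hD f) :=
  Subtype.ext (funext fun x => congrArg D (leftT_leftT x g f))

lemma leftCoeff_rightT (D : testSpace F m →ₗ[ℂ] ℂ)
    (hD : ∀ p ∈ borelSubgroup m F, ∀ f, D (leftT p f) = chiDeltaHalf z p * D f)
    {h : GL (Fin m) F} {c : ℂ} (hh : ∀ f, D (rightT h f) = c * D f) (f : testSpace F m) :
    leftCoeff D hD (rightT h f) = c • leftCoeff D hD f :=
  Subtype.ext (funext fun x => (congrArg D (leftT_rightT x h f)).trans (hh _))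

/-- Evaluation at the identity. -/
def evalOne (z : Fin m → ℂ) : principalSeries (F := F) z →ₗ[ℂ] ℂ :=
  (LinearMap.proj 1).comp (Submodule.subtype _)

/-- Duality of the Casselman basis makes φ ↦ (T_w φ)(1) the coordinate functional. -/
lemma repr_eq_apply_one [MeasurableSpace (GL (Fin m) F)]
    {T : ∀ w : Equiv.Perm (Fin m),
      principalSeries (F := F) z →ₗ[ℂ] principalSeries (F := F) (twist w z)}
    {f : Module.Basis (Equiv.Perm (Fin m)) ℂ (iwahoriInvariants (F := F) z)}
    (hf : IsCasselmanBasis T f) (w : Equiv.Perm (Fin m)) (φ : iwahoriInvariants (F := F) z) :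
    f.repr φ w = evalOne _ (T w φ) := by
  conv_rhs => rw [← f.sum_repr φ]
  rw [Submodule.coe_sum, map_sum, map_sum, Finset.sum_eq_single w]
  · rw [Submodule.coe_smul, map_smul, map_smul]
    change _ = _ * (T w (f w : principalSeries (F := F) z) : GL (Fin m) F → ℂ) 1
    rw [hf w w, if_pos rfl, mul_one]
  · intro w' _ hw'
    rw [Submodule.coe_smul, map_smul, map_smul]
    change _ * (T w (f w' : principalSeries (F := F) z) : GL (Fin m) F → ℂ) 1 = _
    rw [hf w w', if_neg hw'.symm, mul_zero]
  · simp

end Coefficients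

end Shalika

end

/-! ### The main theorem -/

open Shalika in
theorem mainTheorem8
    {F : Type*} [NontriviallyNormedField F] [IsUltrametricDist F] [LocallyCompactSpace F]
    -- a uniformizer, and the normalization of the absolute value
    (ϖ : Fˣ) (hϖ : IsUniformizer (ϖ : F)) (hnorm : ‖(ϖ : F)‖ = (Nat.card (residueField F) : ℝ)⁻¹)
    (ψ : AddChar F ℂ) (hψ : HasConductorIntegers ψ)
    (n : ℕ) [MeasurableSpace (GL (Fin (n + n)) F)] [BorelSpace (GL (Fin (n + n)) F)]
    -- left Haar measure on the Borel subgroup, of mass one on the integral points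
    (μP : MeasureTheory.Measure (borelSubgroup (n + n) F)) [μP.IsHaarMeasure]
    (hμP : μP {p | (p : GL (Fin (n + n)) F) ∈ maxCompact F (n + n)} = 1)
    -- Haar measure on the group, of mass one on the Iwahori subgroup
    (μG : MeasureTheory.Measure (GL (Fin (n + n)) F)) [μG.IsHaarMeasure]
    (hμG : μG (iwahori F (n + n)) = 1)
    -- the character χ = (χ_1, …, χ_n, χ_n⁻¹, …, χ_1⁻¹)
    (z : Fin (n + n) → ℂ) (hz : ∀ i, z i.rev = -z i)
    (Λ : principalSeries (F := F) z →ₗ[ℂ] ℂ) (hΛ : IsShalikaFunctional ψ Λ) :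
    -- the translate of the Iwahori subgroup lies in the open orbit
    (∀ l : Fin n → ℤ, Antitone l → (∀ i, 0 ≤ l i) →
      ∀ b ∈ iwahori F (n + n), b * (gLam ϖ (-l))⁻¹ ∈ openOrbit n F) ∧
    -- the value of the Shalika functional on the translates of φ_B
    (∃ φB : principalSeries (F := F) z, (φB : GL (Fin (n + n)) F → ℂ) = phiB μP z ∧
      (∀ l : Fin n → ℤ, Antitone l → (∀ i, 0 ≤ l i) →
        Λ (R (gLam ϖ (-l)) φB) = chiDeltaHalf (-z) (gLam ϖ l : GL (Fin (n + n)) F) * Λ φB) ∧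
      (IsNormalized μP μG ψ Λ →
        Λ φB = 1 ∧
        ∀ l : Fin n → ℤ, Antitone l → (∀ i, 0 ≤ l i) →
          Λ (R (gLam ϖ (-l)) φB) = chiDeltaHalf (-z) (gLam ϖ l : GL (Fin (n + n)) F))) ∧
    -- the Casselman coefficients
    (∀ T : ∀ w : Equiv.Perm (Fin (n + n)),
        principalSeries (F := F) (-z) →ₗ[ℂ] principalSeries (F := F) (twist w (-z)),
      (∀ w, IsIntertwining w (T w)) →
      ∀ f : Module.Basis (Equiv.Perm (Fin (n + n))) ℂ (iwahoriInvariants (F := F) (-z)),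
        IsCasselmanBasis T f →
        ∀ w ∈ weylSp n, ∀ l : Fin n → ℤ, Antitone l → (∀ i, 0 ≤ l i) →
          casselmanCoeff μP Λ f w (gLam ϖ (-l)) =
            chiDeltaHalf (-twist w z) (gLam ϖ l : GL (Fin (n + n)) F) *
              casselmanCoeff μP Λ f w (gLam ϖ 0) ∧
          (casselmanCoeff μP Λ f w (gLam ϖ 0) ≠ 0 →
            casselmanCoeff μP Λ f w (gLam ϖ (-l)) / casselmanCoeff μP Λ f w (gLam ϖ 0) =
              chiDeltaHalf (-twist w z) (gLam ϖ l : GL (Fin (n + n)) F))) := by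
  have hϖ1 : ‖(ϖ : F)‖ ≤ 1 := ((hϖ _).2 le_rfl).le
  -- the functional `Δ_H` on test functions
  let D : testSpace F (n + n) →ₗ[ℂ] ℂ := Λ.comp (PchiLin μP hϖ hnorm z)
  have hDP : ∀ p ∈ borelSubgroup (n + n) F, ∀ f, D (leftT p f) = chiDeltaHalf (-z) p * D f :=
    fun p hp f => by
      change Λ (PchiLin μP hϖ hnorm z (leftT p f)) = _
      rw [PchiLin_leftT μP hϖ hnorm z hp, map_smul]
      rfl
  have hDH : ∀ h ∈ conjShalika n F, ∀ f, D (rightT h f) = conjShalikaChar ψ h * D f :=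
    fun h hh f => by
      change Λ (PchiLin μP hϖ hnorm z (rightT h f)) = _
      rw [PchiLin_rightT, hΛ h hh]
      rfl
  have hval : ∀ l : Fin n → ℤ, Antitone l → (∀ i, 0 ≤ l i) →
      Λ (R (gLam ϖ (-l)) (PchiLin μP hϖ hnorm z (iwahoriT F (n + n)))) =
        chiDeltaHalf (-z) (gLam ϖ l : GL (Fin (n + n)) F) *
          Λ (PchiLin μP hϖ hnorm z (iwahoriT F (n + n))) := fun l hl hl' => by
    rw [← PchiLin_rightT, gLam_neg]
    exact apply_rightT_iwahoriT hψ D hDP hDH (gLam_antidominant hϖ1 hl hl')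
  refine ⟨fun l hl hl' b hb => ?_, ⟨PchiLin μP hϖ hnorm z (iwahoriT F (n + n)), rfl, hval,
    fun hN => ?_⟩, fun T hT f hf w hw l hl hl' => ?_⟩
  · rw [gLam_neg, inv_inv]
    exact mul_diagGL_mem_openOrbit hψ (gLam_antidominant hϖ1 hl hl') hb
  · have h1 : Λ (PchiLin μP hϖ hnorm z (iwahoriT F (n + n))) = 1 := by
      have hsub : (iwahori F (n + n) : Set (GL (Fin (n + n)) F)) ⊆ openOrbit n F := fun b hb => by
        obtain ⟨p, hp, -, h, hh, -, hbh⟩ := exists_borel_mul_conjShalika hψ hb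
        exact ⟨(⟨p, hp⟩, ⟨h, hh⟩), hbh⟩
      have hm : MeasurableSet (iwahori F (n + n) : Set (GL (Fin (n + n)) F)) :=
        isOpen_iwahori.measurableSet
      have h := hN (iwahoriT F (n + n)).1
        ⟨isLocallyConstant_of_mem_testSpace (iwahoriT F (n + n)).2, (iwahoriT F (n + n)).2.1⟩
        (Set.support_indicator_subset.trans hsub)
      -- The kernel is 1 on B, so the normalizing integral of 1_B is the volume of B.
      have h2 : ∀ x, openOrbitKernel ψ z x * (iwahoriT F (n + n)).1 x =
          (iwahori F (n + n) : Set (GL (Fin (n + n)) F)).indicator 1 x := fun x => by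
        change _ * (iwahori F (n + n) : Set (GL (Fin (n + n)) F)).indicator 1 x = _
        by_cases hx : x ∈ (iwahori F (n + n) : Set (GL (Fin (n + n)) F))
        · rw [openOrbitKernel_eq_one hψ hz hx, one_mul]
        · rw [Set.indicator_of_notMem hx, mul_zero]
      rw [distribution_eq μP hϖ hnorm] at h
      simp_rw [h2] at h
      rw [h, setIntegral_indicator hm, Set.inter_eq_right.2 hsub]
      simp [Measure.real, hμG]
    refine ⟨h1, fun l hl hl' => ?_⟩
    rw [hval l hl hl', h1, mul_one]
  · let S := leftCoeff D hDP
    -- Passing through T_w changes the left character to that of I(^wχ⁻¹) and keeps the right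
    -- equivariance under H, so the core lemma applies to `D'` as it did to `D`.
    let D' : testSpace F (n + n) →ₗ[ℂ] ℂ := (evalOne _).comp ((T w).comp S)
    have hcoeff : ∀ g, casselmanCoeff μP Λ f w g = D' (rightT g (iwahoriT F (n + n))) := by
      intro g
      unfold casselmanCoeff
      rw [repr_eq_apply_one hf]
      change evalOne _ (T w _) = evalOne _ (T w _)
      congr 2
      refine Subtype.ext (funext fun x => ?_)
      -- As left and right translations commute, the projection to the B-invariants is `S` applied
      -- to the right translate of 1_B.
      change distribution μP Λ (rightT g (leftT x (iwahoriT F (n + n)))).1 =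
        D (leftT x (rightT g (iwahoriT F (n + n))))
      rw [leftT_rightT]
      exact distribution_eq μP hϖ hnorm Λ _
    have hDP' : ∀ p ∈ borelSubgroup (n + n) F, ∀ f,
        D' (leftT p f) = chiDeltaHalf (twist w (-z)) p * D' f := fun p hp f => by
      change (T w (S (leftT p f)) : GL (Fin (n + n)) F → ℂ) 1 =
        _ * (T w (S f) : GL (Fin (n + n)) F → ℂ) 1
      -- Translating by `p` and evaluating at 1 is evaluating at `p`, where the transformation law
      -- of I(^wχ⁻¹) gives the character.
      rw [leftCoeff_leftT, (hT w).equivariant, ← (T w (S f)).2.2 p hp 1, mul_one]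
      exact congrArg (T w (S f) : GL (Fin (n + n)) F → ℂ) (one_mul p)
    have hDH' : ∀ h ∈ conjShalika n F, ∀ f, D' (rightT h f) = conjShalikaChar ψ h * D' f :=
      fun h hh f => by
        change evalOne _ (T w (S (rightT h f))) = _
        rw [leftCoeff_rightT D hDP (hDH h hh), map_smul, map_smul]
        rfl
    have hmain : casselmanCoeff μP Λ f w (gLam ϖ (-l)) =
        chiDeltaHalf (-twist w z) (gLam ϖ l : GL (Fin (n + n)) F) *
          casselmanCoeff μP Λ f w (gLam ϖ 0) := by
      rw [hcoeff, hcoeff, gLam_zero, rightT_one, gLam_neg]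
      -- The parameters `twist w (-z)` and `-twist w z` agree by definition.
      exact apply_rightT_iwahoriT hψ D' hDP' hDH' (gLam_antidominant hϖ1 hl hl')
    exact ⟨hmain, fun h0 => by rw [hmain, mul_div_cancel_right₀ _ h0]⟩
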